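/- Consider $7$ identical point vortices of vorticity $\kappa\in\mathbb{R}\setminus\{0\}$ in the plane $\mathbb{C}$. The phase space is the set of $z=(z_1,\dots,z_7)\in\mathbb{C}^7$ with pairwise distinct entries, with the Hamiltonian $$H(z)=-\frac{\kappa^2}{4\pi}\sum_{i<j}\log|z_i-z_j|^2,$$ the symplectic form $\Omega=\sum_j 2\kappa\,dx_j\wedge dy_j$, and Hamilton's equations $\Omega(\dot z,\cdot)=dH$. The group $\mathsf{SE}(2)$ of maps $z\mapsto az+b$ ($|a|=1$, $b\in\mathbb{C}$) acts diagonally, with momentum map $\mathbf{J}(z)=\kappa\sum_j(z_j,|z_j|^2)\in\mathbb{C}\times\mathbb{R}$, which is equivariant for the affine coadjoint action $(a,b)\cdot(m,p)=(am+7\kappa b,\;p+2\,\mathrm{Re}(\bar b\,am)+7\kappa|b|^2)$. Let $c\in\mathbb{C}$ and $w\in\mathbb{C}\setminus\{0\}$. The Thomson heptagon, i.e. the regular ring with centre $c$ and vertices $c+w\,e^{2\pi\mathrm{i}j/7}$, is a relative equilibrium: the curve $$\gamma_0(t)=\bigl(c+e^{\mathrm{i}\omega t}\,w\,e^{2\pi\mathrm{i}j/7}\bigr)_j,\qquad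 \omega=\frac{6\kappa}{8\pi|w|^2},$$ is a trajectory. Moreover it is nonlinearly (Lyapunov) stable modulo rotations: let $\mu=\mathbf{J}(\gamma_0(0))$ and let $G_\mu\subset\mathsf{SE}(2)$ be its stabilizer (the group of rotations about $c$). For every $G_\mu$-invariant neighbourhood $V$ of the trajectory $\gamma_0(\mathbb{R})$ in the phase space there is a $G_\mu$-invariant neighbourhood $U\subseteq V$ of $\gamma_0(\mathbb{R})$ such that every trajectory starting in $U$ exists and remains in $V$ for all time $t\in\mathbb{R}$. -/

import Mathlib

open scoped Topology

/-- The phase space of `n` point vortices in the plane: configurations without collisions. -/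
def vortexPhaseSpace (n : ℕ) : Set (Fin n → ℂ) := {z | Function.Injective z}

/-- The Hamiltonian of `n` identical point vortices of vorticity `κ` in the plane,
`H(z) = -(κ² / 4π) ∑_{i<j} log |z_i - z_j|²`. -/
noncomputable def vortexHamiltonian {n : ℕ} (κ : ℝ) (z : Fin n → ℂ) : ℝ :=
  -(κ ^ 2 / (4 * Real.pi)) * ∑ i, ∑ j ∈ Finset.Ioi i, Real.log (‖z i - z j‖ ^ 2)

/-- The symplectic form `κ Ω ⊕ ⋯ ⊕ κ Ω` with `Ω = 2 dx ∧ dy`. -/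
noncomputable def vortexSymplecticForm {n : ℕ} (κ : ℝ) (u v : Fin n → ℂ) : ℝ :=
  ∑ j, κ * (2 * ((u j).re * (v j).im - (u j).im * (v j).re))

/-- A (complete) trajectory of `n` identical point vortices of vorticity `κ`: a differentiable
curve `γ : ℝ → phase space` satisfying Hamilton's equations `Ω(γ', ·) = dH`. -/
def IsVortexTrajectory {n : ℕ} (κ : ℝ) (γ : ℝ → Fin n → ℂ) : Prop :=
  ∀ t, γ t ∈ vortexPhaseSpace n ∧ DifferentiableAt ℝ γ t ∧
    ∀ v : Fin n → ℂ,
      vortexSymplecticForm κ (deriv γ t) v = fderiv ℝ (vortexHamiltonian κ) (γ t) v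

/-- The diagonal action on configurations of the orientation-preserving isometry
`z ↦ a z + b` of the plane (an element of `SE(2)`). -/
def planeMotion {n : ℕ} (a : Circle) (b : ℂ) (z : Fin n → ℂ) : Fin n → ℂ :=
  fun j => a * z j + b

/-- The momentum map `J(z) = κ ∑_j (z_j, |z_j|²)` of the action of `SE(2)`. -/
noncomputable def vortexMomentum {n : ℕ} (κ : ℝ) (z : Fin n → ℂ) : ℂ × ℝ :=
  (∑ j, κ * z j, ∑ j, κ * ‖z j‖ ^ 2)

/-- The affine coadjoint action of `SE(2)` on momentum values, for a vortex system of total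
vorticity `Γ`; this is the action that makes the momentum map equivariant. -/
noncomputable def affineCoadjoint (Γ : ℝ) (a : Circle) (b : ℂ) (μ : ℂ × ℝ) : ℂ × ℝ :=
  (a * μ.1 + Γ * b, μ.2 + 2 * (starRingEnd ℂ b * (a * μ.1)).re + Γ * ‖b‖ ^ 2)

/-- Equivariance of the momentum map. -/
theorem vortexMomentum_planeMotion {n : ℕ} (κ : ℝ) (a : Circle) (b : ℂ) (z : Fin n → ℂ) :
    vortexMomentum κ (planeMotion a b z) =
      affineCoadjoint (n * κ) a b (vortexMomentum κ z) := by
  have h : ∀ j, ‖(a : ℂ) * z j + b‖ ^ 2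
      = ‖z j‖ ^ 2 + 2 * (starRingEnd ℂ b * (a * z j)).re + ‖b‖ ^ 2 := by
    intro j
    have ha : ‖(a : ℂ) * z j‖ = ‖z j‖ := by rw [norm_mul, Circle.norm_coe, one_mul]
    rw [← ha]
    simp only [← Complex.normSq_eq_norm_sq, Complex.normSq_add]
    rw [mul_comm (starRingEnd ℂ b)]
    ring
  unfold vortexMomentum planeMotion affineCoadjoint
  refine Prod.ext ?_ ?_
  · simp only [mul_add, Finset.sum_add_distrib, Finset.mul_sum]
    simp
    congr 1
    · exact Finset.sum_congr rfl fun j _ => by ring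
    · ring
  · simp only [h, mul_add, Finset.sum_add_distrib, Finset.mul_sum, Complex.re_sum]
    simp
    congr 1
    · congr 1
      exact Finset.sum_congr rfl fun j _ => by ring
    · ring

/-- A set of configurations is invariant under the stabilizer `G_μ ⊆ SE(2)` of the momentum
value `μ`. -/
def IsStabilizerInvariant {n : ℕ} (κ : ℝ) (μ : ℂ × ℝ) (S : Set (Fin n → ℂ)) : Prop :=
  ∀ (a : Circle) (b : ℂ), affineCoadjoint (n * κ) a b μ = μ →
    ∀ z ∈ S, planeMotion a b z ∈ S

/-- Lyapunov stability of a trajectory `γ₀` (a relative equilibrium) in terms of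
`G_μ`-invariant neighbourhoods, where `μ` is the momentum value at `γ₀`: for every
`G_μ`-invariant neighbourhood `V` of `γ₀` there is a `G_μ`-invariant neighbourhood `U ⊆ V` of
`γ₀` such that the trajectory through any point of `U` exists and remains in `V` for all time. -/
def IsVortexLyapunovStable {n : ℕ} (κ : ℝ) (γ₀ : ℝ → Fin n → ℂ) : Prop :=
  ∀ V ⊆ vortexPhaseSpace n, V ∈ 𝓝ˢ (Set.range γ₀) →
    IsStabilizerInvariant κ (vortexMomentum κ (γ₀ 0)) V →
    ∃ U ⊆ V, U ∈ 𝓝ˢ (Set.range γ₀) ∧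
      IsStabilizerInvariant κ (vortexMomentum κ (γ₀ 0)) U ∧
      ∀ z ∈ U, (∃ γ, IsVortexTrajectory κ γ ∧ γ 0 = z) ∧
        ∀ γ, IsVortexTrajectory κ γ → γ 0 = z → ∀ t, γ t ∈ V

/-- The regular `n`-gon with centre `c` and first vertex `c + w`, rotating rigidly about its
centre with angular velocity `(n - 1) κ / (8 π |w|²)`. -/
noncomputable def rotatingRing (n : ℕ) (κ : ℝ) (c w : ℂ) (t : ℝ) : Fin n → ℂ :=
  fun j => c + Complex.exp (((n - 1) * κ / (8 * Real.pi * ‖w‖ ^ 2) * t : ℝ) * Complex.I) *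
    (w * Complex.exp (2 * Real.pi * Complex.I * j / n))

/-! The energy–momentum method applies, but the Hessian is degenerate, so the expansion goes to
fourth order. Amending the Hamiltonian by the angular impulse about the centre gives a conserved
function with the heptagon as a critical point; the claim is that the heptagon is a local maximum in
the full phase space, strict modulo rotations. No restriction to a momentum level is needed.

For the unit ring `X i = ζ ^ i`, write the perturbation as `∑ k, a k * X i ^ k`. Differences of
vertices are then multiplied by `1 + d`, with `d` a polynomial in `X i` and `X m`, and the power
sums of the roots of unity evaluate the Taylor polynomial of `log ‖1 + d‖` exactly. On the slice
where `a 1` is real, the quadratic part is negative semidefinite and degenerates only on the plane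
`a 4 = conj (a 5)`. With `y = a 5`, the cubic terms in `y` cancel. The quartic term is `-357 ‖y‖ ^
4`; coupling to `a 1` and `a 2` through `D ^ 2 * E` gives back at most `245 ‖y‖ ^ 4`, so the balance
stays negative (`taylor_le`, `sum_log_le`, `amendedEnergy_lt_of_slice`).

A strict maximum on a compact orbit traps all curves conserving the function
(`exists_stable_superlevel`). Trapped solutions keep their vortices apart, so they are solutions of
a globally Lipschitz regularised field and exist for all time. Criticality of the ring also yields
its equation of motion. -/

/-! ### Power sums of the seventh roots of unity -/

section RootsOfUnity

variable {ζ : ℂ}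

theorem IsPrimitiveRoot.sum_fin_pow {n : ℕ} (hζ : IsPrimitiveRoot ζ n) (k : ℕ) :
    ∑ i : Fin n, (ζ ^ (i : ℕ)) ^ k = if n ∣ k then (n : ℂ) else 0 := by
  rw [Fin.sum_univ_eq_sum_range (fun i => (ζ ^ i) ^ k) n]
  have h : ∀ i, (ζ ^ i) ^ k = (ζ ^ k) ^ i := fun i => by rw [← pow_mul, ← pow_mul, mul_comm]
  simp only [h]
  split_ifs with hk
  · rw [(hζ.pow_eq_one_iff_dvd k).2 hk]; simp
  · have h1 : ζ ^ k ≠ 1 := fun h => hk ((hζ.pow_eq_one_iff_dvd k).1 h)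
    rw [geom_sum_eq h1, ← pow_mul, mul_comm, pow_mul, hζ.pow_eq_one]; simp

/-- A family with the power sums of the seventh roots of unity, `X 0 = 1` being the first. -/
structure IsSeventhRoots (X : Fin 7 → ℂ) : Prop where
  zero : X 0 = 1
  add : ∀ i j, X (i + j) = X i * X j
  sum_pow : ∀ k : ℕ, ∑ i, X i ^ k = if 7 ∣ k then 7 else 0

namespace IsSeventhRoots

theorem of_primitiveRoot (hζ : IsPrimitiveRoot ζ 7) :
    IsSeventhRoots fun i : Fin 7 => ζ ^ (i : ℕ) :=
  ⟨by simp, fun i j => by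
      rw [Fin.val_add, ← pow_add, ← pow_eq_pow_mod _ hζ.pow_eq_one],
    fun k => by simpa using hζ.sum_fin_pow k⟩

variable {X : Fin 7 → ℂ}

theorem sum_const_mul_pow (h : IsSeventhRoots X) (c : ℂ) (k : ℕ) :
    ∑ i, c * X i ^ k = c * if 7 ∣ k then 7 else 0 := by
  rw [← Finset.mul_sum, h.sum_pow]

theorem sum_compl (h : IsSeventhRoots X) (p : ℂ → ℂ) :
    ∑ m ∈ ({0}ᶜ : Finset (Fin 7)), p (X m) = ∑ m, p (X m) - p 1 := by
  rw [← Finset.sum_compl_add_sum ({0} : Finset (Fin 7)) (fun m => p (X m)), Finset.sum_singleton, h.zero]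
  ring

/-- The sum of `1 + x + ⋯ + x ^ (k - 1)`. -/
def geom (k : ℕ) (x : ℂ) : ℂ := ∑ l ∈ Finset.range k, x ^ l

/-- In the expanded product only exponents divisible by 7 survive, each contributing 7; the omitted
index `m = 0` has value `3 * 6`. Here exponents 0 and 7 occur once each, giving `14 - 18`. The next
three sums follow the same count. -/
theorem sum_geom_three_mul_six (h : IsSeventhRoots X) :
    ∑ m ∈ ({0}ᶜ : Finset (Fin 7)), geom 3 (X m) * geom 6 (X m) = -4 := by
  rw [h.sum_compl fun x => geom 3 x * geom 6 x]
  simp only [geom, Finset.sum_range_succ, Finset.sum_range_zero]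
  ring_nf
  simp only [Finset.sum_add_distrib, ← Finset.sum_mul, h.sum_pow]
  have := h.sum_pow 1
  simp at this ⊢
  rw [this]; norm_num

theorem sum_geom_four_mul_five (h : IsSeventhRoots X) :
    ∑ m ∈ ({0}ᶜ : Finset (Fin 7)), geom 4 (X m) * geom 5 (X m) = -6 := by
  rw [h.sum_compl fun x => geom 4 x * geom 5 x]
  simp only [geom, Finset.sum_range_succ, Finset.sum_range_zero]
  ring_nf
  simp only [Finset.sum_add_distrib, ← Finset.sum_mul, h.sum_pow]
  have := h.sum_pow 1
  simp at this ⊢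
  rw [this]; norm_num

theorem sum_geom_four_sq_mul_two (h : IsSeventhRoots X) :
    ∑ m ∈ ({0}ᶜ : Finset (Fin 7)), geom 4 (X m) ^ 2 * geom 2 (X m) = -18 := by
  rw [h.sum_compl fun x => geom 4 x ^ 2 * geom 2 x]
  simp only [geom, Finset.sum_range_succ, Finset.sum_range_zero]
  ring_nf
  simp only [Finset.sum_add_distrib, ← Finset.sum_mul, h.sum_pow]
  have := h.sum_pow 1
  simp at this ⊢
  rw [this]; norm_num

theorem sum_geom_four_sq_mul_five_sq (h : IsSeventhRoots X) :
    ∑ m ∈ ({0}ᶜ : Finset (Fin 7)), geom 4 (X m) ^ 2 * geom 5 (X m) ^ 2 = 34 := by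
  rw [h.sum_compl fun x => geom 4 x ^ 2 * geom 5 x ^ 2]
  simp only [geom, Finset.sum_range_succ, Finset.sum_range_zero]
  ring_nf
  simp only [Finset.sum_add_distrib, ← Finset.sum_mul, h.sum_pow]
  have := h.sum_pow 1
  simp at this ⊢
  rw [this]; norm_num

theorem sum_polynomial (h : IsSeventhRoots X) (b₁ b₂ b₃ b₄ b₅ b₆ : ℂ) :
    ∑ i, (b₁ + b₂ * X i + b₃ * X i ^ 2 + b₄ * X i ^ 3 + b₅ * X i ^ 4 + b₆ * X i ^ 5) = 7 * b₁ := by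
  have e : ∀ i, b₁ + b₂ * X i + b₃ * X i ^ 2 + b₄ * X i ^ 3 + b₅ * X i ^ 4 + b₆ * X i ^ 5 =
      b₁ * X i ^ 0 + b₂ * X i ^ 1 + b₃ * X i ^ 2 + b₄ * X i ^ 3 + b₅ * X i ^ 4 + b₆ * X i ^ 5 :=
    fun i => by ring
  simp only [e, Finset.sum_add_distrib, h.sum_const_mul_pow]
  norm_num; ring

theorem sum_polynomial_sq (h : IsSeventhRoots X) (b₁ b₂ b₃ b₄ b₅ b₆ : ℂ) :
    ∑ i, (b₁ + b₂ * X i + b₃ * X i ^ 2 + b₄ * X i ^ 3 + b₅ * X i ^ 4 + b₆ * X i ^ 5) ^ 2 =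
      7 * (b₁ ^ 2 + 2 * (b₃ * b₆) + 2 * (b₄ * b₅)) := by
  have e : ∀ i, (b₁ + b₂ * X i + b₃ * X i ^ 2 + b₄ * X i ^ 3 + b₅ * X i ^ 4 + b₆ * X i ^ 5) ^ 2 =
      b₁ ^ 2 * X i ^ 0 + 2 * b₁ * b₂ * X i ^ 1 + (b₂ ^ 2 + 2 * b₁ * b₃) * X i ^ 2 +
        (2 * b₁ * b₄ + 2 * b₂ * b₃) * X i ^ 3 + (2 * b₁ * b₅ + 2 * b₂ * b₄ + b₃ ^ 2) * X i ^ 4 +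
        (2 * b₁ * b₆ + 2 * b₂ * b₅ + 2 * b₃ * b₄) * X i ^ 5 +
        (2 * b₂ * b₆ + 2 * b₃ * b₅ + b₄ ^ 2) * X i ^ 6 + (2 * b₃ * b₆ + 2 * b₄ * b₅) * X i ^ 7 +
        (2 * b₄ * b₆ + b₅ ^ 2) * X i ^ 8 + 2 * b₅ * b₆ * X i ^ 9 + b₆ ^ 2 * X i ^ 10 :=
    fun i => by ring
  simp only [e, Finset.sum_add_distrib, h.sum_const_mul_pow]
  norm_num; ring

theorem sum_binomial_cube (h : IsSeventhRoots X) (b₄ b₅ : ℂ) :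
    ∑ i, (b₄ * X i ^ 3 + b₅ * X i ^ 4) ^ 3 = 0 := by
  have e : ∀ i, (b₄ * X i ^ 3 + b₅ * X i ^ 4) ^ 3 = b₄ ^ 3 * X i ^ 9 + 3 * b₄ ^ 2 * b₅ * X i ^ 10 +
      3 * b₄ * b₅ ^ 2 * X i ^ 11 + b₅ ^ 3 * X i ^ 12 := fun i => by ring
  simp only [e, Finset.sum_add_distrib, h.sum_const_mul_pow]
  norm_num

theorem sum_binomial_pow_four (h : IsSeventhRoots X) (b₄ b₅ : ℂ) :
    ∑ i, (b₄ * X i ^ 3 + b₅ * X i ^ 4) ^ 4 = 42 * (b₄ ^ 2 * b₅ ^ 2) := by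
  have e : ∀ i, (b₄ * X i ^ 3 + b₅ * X i ^ 4) ^ 4 = b₄ ^ 4 * X i ^ 12 +
      4 * b₄ ^ 3 * b₅ * X i ^ 13 + 6 * (b₄ ^ 2 * b₅ ^ 2) * X i ^ 14 +
      4 * b₄ * b₅ ^ 3 * X i ^ 15 + b₅ ^ 4 * X i ^ 16 := fun i => by ring
  simp only [e, Finset.sum_add_distrib, h.sum_const_mul_pow]
  norm_num; ring

theorem sum_binomial_sq_mul (h : IsSeventhRoots X) (b₁ b₂ b₃ b b₆ b₄ b₅ : ℂ) :
    ∑ i, (b₄ * X i ^ 3 + b₅ * X i ^ 4) ^ 2 *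
      (b₁ + b₂ * X i + b₃ * X i ^ 2 + b * X i ^ 3 + b₆ * X i ^ 5) =
      7 * (b₄ ^ 2 * b₂) + 14 * (b₄ * b₅ * b₁) := by
  have e : ∀ i, (b₄ * X i ^ 3 + b₅ * X i ^ 4) ^ 2 *
      (b₁ + b₂ * X i + b₃ * X i ^ 2 + b * X i ^ 3 + b₆ * X i ^ 5) =
      b₄ ^ 2 * b₁ * X i ^ 6 + (2 * b₄ * b₅ * b₁ + b₄ ^ 2 * b₂) * X i ^ 7 +
      (b₅ ^ 2 * b₁ + 2 * b₄ * b₅ * b₂ + b₄ ^ 2 * b₃) * X i ^ 8 +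
      (b₅ ^ 2 * b₂ + 2 * b₄ * b₅ * b₃ + b₄ ^ 2 * b) * X i ^ 9 +
      (b₅ ^ 2 * b₃ + 2 * b₄ * b₅ * b) * X i ^ 10 +
      (b₅ ^ 2 * b + b₄ ^ 2 * b₆) * X i ^ 11 + 2 * b₄ * b₅ * b₆ * X i ^ 12 +
      b₅ ^ 2 * b₆ * X i ^ 13 := fun i => by ring
  simp only [e, Finset.sum_add_distrib, h.sum_const_mul_pow]
  norm_num; ring

end IsSeventhRoots

end RootsOfUnity

/-! ### Pair sums and the fourth-order expansion of the logarithm -/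

/-- Every unordered pair occurs twice as `(i, i + m)` with `m ≠ 0`, whence the factor one half. -/
theorem Fin.sum_sum_Ioi_eq {n : ℕ} [NeZero n] (f : Fin n → Fin n → ℝ) (hf : ∀ i j, f i j = f j i) :
    ∑ i, ∑ j ∈ Finset.Ioi i, f i j =
      (1 / 2) * ∑ m ∈ ({0}ᶜ : Finset (Fin n)), ∑ i, f i (i + m) := by
  have h1 : ∑ i, ∑ j ∈ Finset.Ioi i, f i j = ∑ i, ∑ j ∈ Finset.Iio i, f i j := by
    rw [Finset.sum_comm' (t' := Finset.univ) (s' := fun j => Finset.Iio j) (by simp)]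
    exact Finset.sum_congr rfl fun i _ => Finset.sum_congr rfl fun j _ => hf _ _
  have h2 : ∑ m ∈ ({0}ᶜ : Finset (Fin n)), ∑ i, f i (i + m) = ∑ i, ∑ j ∈ ({i}ᶜ : Finset (Fin n)), f i j := by
    rw [Finset.sum_comm]
    refine Finset.sum_congr rfl fun i _ => ?_
    refine Finset.sum_bij (fun m _ => i + m) (by simp) (by simp) (fun j hj => ⟨j - i, ?_, by simp⟩) (by simp)
    simpa [sub_eq_zero] using hj
  have h3 : ∀ i : Fin n, ∑ j ∈ ({i}ᶜ : Finset (Fin n)), f i j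
      = ∑ j ∈ Finset.Ioi i, f i j + ∑ j ∈ Finset.Iio i, f i j := by
    intro i
    rw [← Finset.sum_union]
    · congr 1; ext j; simp [lt_or_lt_iff_ne, ne_comm]
    · exact Finset.disjoint_left.2 fun j hj hj' => by simp at hj hj'; exact absurd hj (not_lt.2 hj'.le)
  rw [h2, Finset.sum_congr rfl fun i _ => h3 i, Finset.sum_add_distrib, ← h1]; ring

theorem log_norm_one_add_le {d : ℂ} (hd : ‖d‖ ≤ 1 / 2) :
    Real.log ‖1 + d‖ ≤ (d - d ^ 2 / 2 + d ^ 3 / 3 - d ^ 4 / 4).re + ‖d‖ ^ 5 := by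
  have h := Complex.norm_log_sub_logTaylor_le 4 (z := d) (by linarith)
  have h1 : Complex.logTaylor (4 + 1) d = d - d ^ 2 / 2 + d ^ 3 / 3 - d ^ 4 / 4 := by
    simp [Complex.logTaylor_succ, Complex.logTaylor_zero]; ring
  rw [h1] at h
  have h2 := (Complex.re_le_norm _).trans h
  rw [Complex.sub_re, Complex.log_re] at h2
  have h3 : (1 - ‖d‖)⁻¹ ≤ 2 := by
    rw [inv_le_comm₀] <;> linarith
  have h4 : ‖d‖ ^ (4 + 1) * (1 - ‖d‖)⁻¹ / ((4 : ℕ) + 1) ≤ ‖d‖ ^ 5 := by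
    have : ‖d‖ ^ 5 * (1 - ‖d‖)⁻¹ ≤ ‖d‖ ^ 5 * 2 := by gcongr
    have : 0 ≤ ‖d‖ ^ 5 := by positivity
    push_cast; norm_num; linarith
  linarith

/-- Give `D` weight 1 and `E` weight 2. All terms of weight at most 4 are kept; the rest have weight
at least 5 and are `δ` times `x ^ 2 + t ^ 4`, up to a constant. -/
theorem log_norm_one_add_add_le {D E : ℂ} {t x δ : ℝ} (ht : 0 ≤ t) (hx : 0 ≤ x) (htδ : t ≤ δ)
    (hxδ : x ≤ δ) (hδ : δ ≤ 1 / 100) (hD : ‖D‖ ≤ 9 * t) (hE : ‖E‖ ≤ 9 * x) :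
    Real.log ‖1 + (D + E)‖ ≤
      ((D + E) - (D + E) ^ 2 / 2 + (D ^ 3 + 3 * (D ^ 2 * E)) / 3 - D ^ 4 / 4).re +
        10 ^ 6 * δ * (x ^ 2 + t ^ 4) := by
  have hd : ‖D + E‖ ≤ 9 * (t + x) := (norm_add_le _ _).trans (by linarith)
  have h := log_norm_one_add_le (d := D + E) (by linarith)
  have hδ0 : 0 ≤ δ := ht.trans htδ
  -- The second bracket collects what is discarded from the cubic and quartic terms.
  have e : (D + E) - (D + E) ^ 2 / 2 + (D + E) ^ 3 / 3 - (D + E) ^ 4 / 4 =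
      ((D + E) - (D + E) ^ 2 / 2 + (D ^ 3 + 3 * (D ^ 2 * E)) / 3 - D ^ 4 / 4) +
      (D * E ^ 2 + (E ^ 3 / 3 + -(E * ((D + E) ^ 3 + (D + E) ^ 2 * D + (D + E) * D ^ 2 + D ^ 3) / 4))) := by
    ring
  rw [e, Complex.add_re] at h
  have h1 : ‖D * E ^ 2‖ ≤ 729 * (δ * x ^ 2) := by
    rw [norm_mul, norm_pow]
    calc ‖D‖ * ‖E‖ ^ 2 ≤ (9 * δ) * (9 * x) ^ 2 := by gcongr; linarith
      _ = _ := by ring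
  have h2 : ‖E ^ 3 / 3‖ ≤ 243 * (δ * x ^ 2) := by
    rw [norm_div, norm_pow]
    calc ‖E‖ ^ 3 / ‖(3 : ℂ)‖ = ‖E‖ * ‖E‖ ^ 2 / 3 := by norm_num; ring
      _ ≤ (9 * δ) * (9 * x) ^ 2 / 3 := by gcongr; linarith
      _ = _ := by ring
  have hDx : ‖D‖ ≤ 9 * (t + x) := by linarith
  have hcube : (t + x) ^ 3 ≤ 4 * (t ^ 3 + x ^ 3) := by
    nlinarith [mul_nonneg (add_nonneg ht hx) (sq_nonneg (t - x))]
  have hfive : (t + x) ^ 5 ≤ 16 * (t ^ 5 + x ^ 5) := by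
    have := add_pow_le ht hx 5
    norm_num at this; exact this
  have hx2 : 0 ≤ x ^ 2 := by positivity
  have ht4 : 0 ≤ t ^ 4 := by positivity
  have hxx : x * (t + x) ^ 3 ≤ 6 * (δ * (x ^ 2 + t ^ 4)) := by
    have a1 : x * t ^ 3 ≤ δ * (x ^ 2 + t ^ 4) / 2 := by
      have : x * t ^ 3 = t * (x * t ^ 2) := by ring
      rw [this]
      have b : x * t ^ 2 ≤ (x ^ 2 + t ^ 4) / 2 := by nlinarith [sq_nonneg (x - t ^ 2)]
      calc t * (x * t ^ 2) ≤ δ * ((x ^ 2 + t ^ 4) / 2) := by gcongr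
        _ = _ := by ring
    have a2 : x * x ^ 3 ≤ δ * x ^ 2 := by
      calc x * x ^ 3 = x * x * x ^ 2 := by ring
        _ ≤ δ * 1 * x ^ 2 := by gcongr; linarith
        _ = _ := by ring
    have a3 : 0 ≤ δ * t ^ 4 := by positivity
    nlinarith
  have h3 : ‖-(E * ((D + E) ^ 3 + (D + E) ^ 2 * D + (D + E) * D ^ 2 + D ^ 3) / 4)‖ ≤
      6561 * (6 * (δ * (x ^ 2 + t ^ 4))) := by
    rw [norm_neg, norm_div, norm_mul]
    have : ‖(D + E) ^ 3 + (D + E) ^ 2 * D + (D + E) * D ^ 2 + D ^ 3‖ ≤ 4 * (9 * (t + x)) ^ 3 := by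
      calc _ ≤ ‖D + E‖ ^ 3 + ‖D + E‖ ^ 2 * ‖D‖ + ‖D + E‖ * ‖D‖ ^ 2 + ‖D‖ ^ 3 := by
            simp only [← norm_pow, ← norm_mul]
            exact norm_add₄_le
        _ ≤ (9 * (t + x)) ^ 3 + (9 * (t + x)) ^ 2 * (9 * (t + x)) +
            (9 * (t + x)) * (9 * (t + x)) ^ 2 + (9 * (t + x)) ^ 3 := by gcongr
        _ = _ := by ring
    calc _ ≤ 9 * x * (4 * (9 * (t + x)) ^ 3) / 4 := by
          rw [show ‖(4 : ℂ)‖ = 4 by norm_num]; gcongr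
      _ = 6561 * (x * (t + x) ^ 3) := by ring
      _ ≤ _ := by gcongr
  have h5 : ‖D + E‖ ^ 5 ≤ 944784 * (δ * (x ^ 2 + t ^ 4)) := by
    have a1 : t ^ 5 ≤ δ * t ^ 4 := by
      calc t ^ 5 = t * t ^ 4 := by ring
        _ ≤ _ := by gcongr
    have a2 : x ^ 5 ≤ δ * x ^ 2 := by
      calc x ^ 5 = x * x ^ 2 * x ^ 2 := by ring
        _ ≤ δ * 1 ^ 2 * x ^ 2 := by gcongr; linarith
        _ = _ := by ring
    calc _ ≤ (9 * (t + x)) ^ 5 := by gcongr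
      _ = 59049 * (t + x) ^ 5 := by ring
      _ ≤ 59049 * (16 * (t ^ 5 + x ^ 5)) := by gcongr
      _ ≤ _ := by nlinarith
  -- The constants add up to `729 + 243 + 39366 + 944784 < 10 ^ 6`.
  have h4 := (Complex.re_le_norm _).trans ((norm_add_le (D * E ^ 2) (E ^ 3 / 3 +
    -(E * ((D + E) ^ 3 + (D + E) ^ 2 * D + (D + E) * D ^ 2 + D ^ 3) / 4))).trans
      (add_le_add h1 ((norm_add_le _ _).trans (add_le_add h2 h3))))
  have : 0 ≤ δ * t ^ 4 := by positivity
  have : 0 ≤ δ * x ^ 2 := by positivity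
  nlinarith

/-! ### The quartic estimate in Fourier coordinates -/

namespace IsSeventhRoots

variable {X : Fin 7 → ℂ}

theorem norm_geom_le {x : ℂ} (hx : ‖x‖ = 1) (k : ℕ) : ‖geom k x‖ ≤ k := by
  refine (norm_sum_le _ _).trans ?_
  simp [hx]

/-- The sum over all pairs of vertices of those terms of the fourth-order Taylor polynomial of
`log (1 + D + E)` that are not negligible when `E` is of the order of `D ^ 2`. -/
theorem sum_taylor (h : IsSeventhRoots X) (r a₂ a₃ e a₆ b y : ℂ) {D E : Fin 7 → Fin 7 → ℂ}
    (hD : ∀ m i, D m i = b * geom 4 (X m) * X i ^ 3 + y * geom 5 (X m) * X i ^ 4)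
    (hE : ∀ m i, E m i = r + a₂ * geom 2 (X m) * X i + a₃ * geom 3 (X m) * X i ^ 2 +
      e * geom 4 (X m) * X i ^ 3 + a₆ * geom 6 (X m) * X i ^ 5) :
    ∑ m ∈ ({0}ᶜ : Finset (Fin 7)), ∑ i, ((D m i + E m i) - (D m i + E m i) ^ 2 / 2 +
      (D m i ^ 3 + 3 * (D m i ^ 2 * E m i)) / 3 - D m i ^ 4 / 4) =
    42 * r - 21 * r ^ 2 + 28 * (a₃ * a₆) + 42 * ((b + e) * y) - 126 * (b ^ 2 * a₂) -
      84 * (b * y * r) - 357 * (b * y) ^ 2 := by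
  -- For fixed `m`, only the powers of `X i` with exponent 0, 7 or 14 survive summation over `i`.
  have key : ∀ m, ∑ i, ((D m i + E m i) - (D m i + E m i) ^ 2 / 2 +
      (D m i ^ 3 + 3 * (D m i ^ 2 * E m i)) / 3 - D m i ^ 4 / 4) =
      (7 * r - 7 / 2 * r ^ 2) - 7 * (a₃ * a₆) * (geom 3 (X m) * geom 6 (X m)) +
      (14 * (b * y * r) - 7 * ((b + e) * y)) * (geom 4 (X m) * geom 5 (X m)) +
      7 * (b ^ 2 * a₂) * (geom 4 (X m) ^ 2 * geom 2 (X m)) -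
      21 / 2 * (b * y) ^ 2 * (geom 4 (X m) ^ 2 * geom 5 (X m) ^ 2) := by
    intro m
    have hDE : ∀ i, D m i + E m i = r + (a₂ * geom 2 (X m)) * X i + (a₃ * geom 3 (X m)) * X i ^ 2 +
        ((b + e) * geom 4 (X m)) * X i ^ 3 + (y * geom 5 (X m)) * X i ^ 4 +
        (a₆ * geom 6 (X m)) * X i ^ 5 := fun i => by rw [hD, hE]; ring
    simp only [Finset.sum_add_distrib, Finset.sum_sub_distrib, ← Finset.sum_div, ← Finset.mul_sum]
    rw [← Finset.sum_add_distrib]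
    simp only [hDE]
    rw [h.sum_polynomial, h.sum_polynomial_sq]
    simp only [hD, hE]
    rw [h.sum_binomial_cube, h.sum_binomial_pow_four, h.sum_binomial_sq_mul]
    ring
  simp only [key, Finset.sum_add_distrib, Finset.sum_sub_distrib, ← Finset.mul_sum,
    h.sum_geom_three_mul_six, h.sum_geom_four_mul_five, h.sum_geom_four_sq_mul_two,
    h.sum_geom_four_sq_mul_five_sq, Finset.sum_const]
  simp [Finset.card_compl]
  ring

/-- The linear terms in `r` cancel, which is criticality. Modes 3 and 6 form a definite block, and
modes 4 and 5 leave only `-21 ‖e‖ ^ 2`, so control of `y` must come from the quartic terms. -/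
theorem taylor_le (r : ℝ) (a₀ a₂ a₃ e a₆ y : ℂ) :
    (42 * (r : ℂ) - 21 * (r : ℂ) ^ 2 + 28 * (a₃ * a₆) + 42 * ((starRingEnd ℂ y + e) * y) -
      126 * (starRingEnd ℂ y ^ 2 * a₂) - 84 * (starRingEnd ℂ y * y * r) -
      357 * (starRingEnd ℂ y * y) ^ 2).re -
      21 * (2 * r + (r ^ 2 + ‖a₀‖ ^ 2 + ‖a₂‖ ^ 2 + ‖a₃‖ ^ 2 + ‖starRingEnd ℂ y + e‖ ^ 2 +
        ‖y‖ ^ 2 + ‖a₆‖ ^ 2)) ≤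
    -(r ^ 2 + ‖a₀‖ ^ 2 + ‖a₂‖ ^ 2 + ‖a₃‖ ^ 2 + ‖e‖ ^ 2 + ‖a₆‖ ^ 2 + ‖y‖ ^ 4) := by
  have h2 : -(starRingEnd ℂ y ^ 2 * a₂).re ≤ ‖y‖ ^ 2 * ‖a₂‖ := by
    have := (neg_le_abs _).trans (Complex.abs_re_le_norm (starRingEnd ℂ y ^ 2 * a₂))
    simpa using this
  have h3 : (a₃ * a₆).re ≤ ‖a₃‖ * ‖a₆‖ := by simpa using Complex.re_le_norm (a₃ * a₆)
  have hy : starRingEnd ℂ y * y = ((‖y‖ ^ 2 : ℝ) : ℂ) := by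
    rw [mul_comm, Complex.mul_conj, Complex.normSq_eq_norm_sq]
  have he : ‖starRingEnd ℂ y + e‖ ^ 2 = ‖y‖ ^ 2 + ‖e‖ ^ 2 + 2 * (e * y).re := by
    rw [← Complex.normSq_eq_norm_sq, Complex.normSq_add, Complex.normSq_eq_norm_sq,
      Complex.normSq_eq_norm_sq, Complex.norm_conj, ← map_mul, Complex.conj_re, mul_comm e]
  have hre : (42 * (r : ℂ) - 21 * (r : ℂ) ^ 2 + 28 * (a₃ * a₆) + 42 * ((starRingEnd ℂ y + e) * y) -
      126 * (starRingEnd ℂ y ^ 2 * a₂) - 84 * (starRingEnd ℂ y * y * r) -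
      357 * (starRingEnd ℂ y * y) ^ 2).re = 42 * r - 21 * r ^ 2 + 28 * (a₃ * a₆).re +
      42 * (‖y‖ ^ 2 + (e * y).re) - 126 * (starRingEnd ℂ y ^ 2 * a₂).re - 84 * (‖y‖ ^ 2 * r) -
      357 * ‖y‖ ^ 4 := by
    have : 42 * (r : ℂ) - 21 * (r : ℂ) ^ 2 + 28 * (a₃ * a₆) + 42 * ((starRingEnd ℂ y + e) * y) -
      126 * (starRingEnd ℂ y ^ 2 * a₂) - 84 * (starRingEnd ℂ y * y * r) -
      357 * (starRingEnd ℂ y * y) ^ 2 = ((42 * r - 21 * r ^ 2 + 42 * ‖y‖ ^ 2 - 84 * (‖y‖ ^ 2 * r) -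
      357 * ‖y‖ ^ 4 : ℝ) : ℂ) + (28 : ℝ) * (a₃ * a₆) + (42 : ℝ) * (e * y)
        - (126 : ℝ) * (starRingEnd ℂ y ^ 2 * a₂) := by
      rw [add_mul, hy]; push_cast; ring
    rw [this]
    simp only [Complex.add_re, Complex.sub_re, Complex.re_ofReal_mul, Complex.ofReal_re]
    ring
  rw [hre, he]
  have hs : ‖y‖ ^ 4 = (‖y‖ ^ 2) ^ 2 := by ring
  rw [hs]
  generalize ‖y‖ ^ 2 = s at *
  -- Completing squares in `r` and `a₂` costs `45 s ^ 2 + 200 s ^ 2`, less than the available `357 s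
  -- ^ 2`.
  have q1 : -40 * r ^ 2 - 84 * (s * r) ≤ 45 * s ^ 2 := by nlinarith [sq_nonneg (40 * r + 42 * s)]
  have q2 : -20 * ‖a₂‖ ^ 2 + 126 * (s * ‖a₂‖) ≤ 200 * s ^ 2 := by
    nlinarith [sq_nonneg (20 * ‖a₂‖ - 63 * s)]
  have q3 : 28 * (‖a₃‖ * ‖a₆‖) ≤ 14 * ‖a₃‖ ^ 2 + 14 * ‖a₆‖ ^ 2 := by
    nlinarith [sq_nonneg (‖a₃‖ - ‖a₆‖)]
  nlinarith [sq_nonneg ‖a₃‖, sq_nonneg ‖a₆‖, sq_nonneg ‖a₀‖, sq_nonneg ‖e‖, sq_nonneg r, sq_nonneg s]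

/-- For small `δ` the Taylor remainder uses up at most half of the negative bound in `taylor_le`. -/
theorem sum_log_le (h : IsSeventhRoots X) (hX : ∀ i, ‖X i‖ = 1) {r : ℝ} {a₀ a₂ a₃ e a₆ y : ℂ}
    {δ : ℝ} (hδ : δ ≤ 10⁻¹ ^ 10) (hr : |r| ≤ δ) (h₂ : ‖a₂‖ ≤ δ) (h₃ : ‖a₃‖ ≤ δ) (he : ‖e‖ ≤ δ)
    (h₆ : ‖a₆‖ ≤ δ) (hy : ‖y‖ ≤ δ) {D E : Fin 7 → Fin 7 → ℂ}
    (hD : ∀ m i, D m i = starRingEnd ℂ y * geom 4 (X m) * X i ^ 3 + y * geom 5 (X m) * X i ^ 4)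
    (hE : ∀ m i, E m i = r + a₂ * geom 2 (X m) * X i + a₃ * geom 3 (X m) * X i ^ 2 +
      e * geom 4 (X m) * X i ^ 3 + a₆ * geom 6 (X m) * X i ^ 5) :
    (∀ m i, 1 + (D m i + E m i) ≠ 0) ∧
    ∑ m ∈ ({0}ᶜ : Finset (Fin 7)), ∑ i, Real.log ‖1 + (D m i + E m i)‖ -
      21 * (2 * r + (r ^ 2 + ‖a₀‖ ^ 2 + ‖a₂‖ ^ 2 + ‖a₃‖ ^ 2 + ‖starRingEnd ℂ y + e‖ ^ 2 +
        ‖y‖ ^ 2 + ‖a₆‖ ^ 2)) ≤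
    -(1 / 2) * (r ^ 2 + ‖a₀‖ ^ 2 + ‖a₂‖ ^ 2 + ‖a₃‖ ^ 2 + ‖e‖ ^ 2 + ‖a₆‖ ^ 2 + ‖y‖ ^ 4) := by
  set x : ℝ := |r| + ‖a₂‖ + ‖a₃‖ + ‖e‖ + ‖a₆‖ with hx
  have hδ0 : 0 ≤ δ := (norm_nonneg _).trans hy
  have hx0 : 0 ≤ x := by positivity
  have hxδ : x ≤ 5 * δ := by linarith
  have hDn : ∀ m i, ‖D m i‖ ≤ 9 * ‖y‖ := by
    intro m i
    rw [hD]
    have h4 := norm_geom_le (hX m) 4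
    have h5 := norm_geom_le (hX m) 5
    push_cast at h4 h5
    refine (norm_add_le _ _).trans ?_
    simp only [norm_mul, norm_pow, hX, one_pow, mul_one, Complex.norm_conj]
    nlinarith [norm_nonneg y]
  have hEn : ∀ m i, ‖E m i‖ ≤ 9 * x := by
    intro m i
    rw [hE]
    have g2 := norm_geom_le (hX m) 2
    have g3 := norm_geom_le (hX m) 3
    have g4 := norm_geom_le (hX m) 4
    have g6 := norm_geom_le (hX m) 6
    push_cast at g2 g3 g4 g6
    calc _ ≤ ‖(r : ℂ)‖ + ‖a₂ * geom 2 (X m) * X i‖ + ‖a₃ * geom 3 (X m) * X i ^ 2‖ +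
        ‖e * geom 4 (X m) * X i ^ 3‖ + ‖a₆ * geom 6 (X m) * X i ^ 5‖ :=
          (norm_add_le _ _).trans (add_le_add_left norm_add₄_le _)
      _ ≤ |r| + ‖a₂‖ * 2 + ‖a₃‖ * 3 + ‖e‖ * 4 + ‖a₆‖ * 6 := by
        simp only [norm_mul, norm_pow, hX, one_pow, mul_one, Complex.norm_real, Real.norm_eq_abs]
        gcongr
      _ ≤ _ := by
        rw [hx]; linarith [abs_nonneg r, norm_nonneg a₂, norm_nonneg a₃, norm_nonneg e, norm_nonneg a₆]
  have hlog : ∀ m i, Real.log ‖1 + (D m i + E m i)‖ ≤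
      ((D m i + E m i) - (D m i + E m i) ^ 2 / 2 +
        (D m i ^ 3 + 3 * (D m i ^ 2 * E m i)) / 3 - D m i ^ 4 / 4).re +
        10 ^ 6 * (5 * δ) * (x ^ 2 + ‖y‖ ^ 4) := fun m i =>
    log_norm_one_add_add_le (norm_nonneg y) hx0 (by linarith) hxδ (by norm_num at hδ; linarith) (hDn m i)
      (hEn m i)
  have hsum := Finset.sum_le_sum (s := ({0}ᶜ : Finset (Fin 7))) fun m _ =>
    Finset.sum_le_sum (s := Finset.univ) fun i _ => hlog m i
  simp only [Finset.sum_add_distrib, ← Complex.re_sum] at hsum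
  rw [h.sum_taylor r a₂ a₃ e a₆ (starRingEnd ℂ y) y hD hE] at hsum
  have hT := taylor_le r a₀ a₂ a₃ e a₆ y
  simp only [Finset.sum_const, Finset.card_compl, Finset.card_univ, Fintype.card_fin,
    Finset.card_singleton, nsmul_eq_mul] at hsum
  push_cast at hsum
  norm_num only at hsum
  have hx2 : x ^ 2 ≤ 5 * (r ^ 2 + ‖a₂‖ ^ 2 + ‖a₃‖ ^ 2 + ‖e‖ ^ 2 + ‖a₆‖ ^ 2) := by
    rw [hx, ← sq_abs r]
    generalize |r| = a, ‖a₂‖ = b, ‖a₃‖ = c, ‖e‖ = d, ‖a₆‖ = f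
    linarith [sq_nonneg (a - b), sq_nonneg (a - c), sq_nonneg (a - d), sq_nonneg (a - f),
      sq_nonneg (b - c), sq_nonneg (b - d), sq_nonneg (b - f), sq_nonneg (c - d),
      sq_nonneg (c - f), sq_nonneg (d - f)]
  -- There are 42 pairs `(m, i)`, and `hx2` costs a factor 5: `42 * 5 / 2000 < 1 / 2`.
  have herr : 6 * (7 * (10 ^ 6 * (5 * δ) * (x ^ 2 + ‖y‖ ^ 4))) ≤
      (1 / 2) * (r ^ 2 + ‖a₀‖ ^ 2 + ‖a₂‖ ^ 2 + ‖a₃‖ ^ 2 + ‖e‖ ^ 2 + ‖a₆‖ ^ 2 + ‖y‖ ^ 4) := by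
    have : 10 ^ 6 * (5 * δ) ≤ 1 / 2000 := by norm_num at hδ; linarith
    have h0 : 0 ≤ x ^ 2 + ‖y‖ ^ 4 := by positivity
    have := mul_le_mul_of_nonneg_right this h0
    have : 0 ≤ ‖y‖ ^ 4 := by positivity
    have : 0 ≤ ‖a₀‖ ^ 2 := by positivity
    linarith
  refine ⟨fun m i h0 => ?_, by linarith⟩
  have h1 : D m i + E m i = -1 := by linear_combination h0
  have h2 := norm_add_le (D m i) (E m i)
  rw [h1, norm_neg, norm_one] at h2
  norm_num at hδ
  linarith [hDn m i, hEn m i]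

end IsSeventhRoots

/-! ### The discrete Fourier transform modulo 7 -/

section FiniteFourier

variable {ζ : ℂ}

theorem IsPrimitiveRoot.conj_pow_eq (hζ : IsPrimitiveRoot ζ 7) (i : ℕ) :
    starRingEnd ℂ (ζ ^ i) = ζ ^ (6 * i) := by
  have h1 : ‖ζ ^ i‖ = 1 := by rw [norm_pow, hζ.norm'_eq_one (by norm_num), one_pow]
  rw [← Complex.inv_eq_conj h1]
  refine inv_eq_of_mul_eq_one_right ?_
  rw [← pow_add, show i + 6 * i = 7 * i by ring, pow_mul, hζ.pow_eq_one, one_pow]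

theorem IsPrimitiveRoot.exists_fourier_coeff (hζ : IsPrimitiveRoot ζ 7) (h : Fin 7 → ℂ) :
    ∃ a : Fin 7 → ℂ, (∀ i : Fin 7, h i = ∑ k, a k * (ζ ^ (i : ℕ)) ^ (k : ℕ)) ∧
      (∀ k, ‖a k‖ ≤ ‖h‖) ∧ a 1 = 7⁻¹ * ∑ l : Fin 7, h l * starRingEnd ℂ (ζ ^ (l : ℕ)) := by
  -- Fourier inversion; the factor 6 stands for `-1` modulo 7, which keeps the exponents natural
  -- numbers.
  refine ⟨fun k => 7⁻¹ * ∑ l : Fin 7, h l * ζ ^ (6 * l * k : ℕ), fun i => ?_, fun k => ?_, ?_⟩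
  · have e : ∀ k : Fin 7, (7⁻¹ * ∑ l : Fin 7, h l * ζ ^ (6 * l * k : ℕ)) * (ζ ^ (i : ℕ)) ^ (k : ℕ) =
        ∑ l : Fin 7, 7⁻¹ * h l * (ζ ^ (k : ℕ)) ^ (6 * l + i : ℕ) := by
      intro k
      rw [mul_assoc, Finset.sum_mul, Finset.mul_sum]
      refine Finset.sum_congr rfl fun l _ => ?_
      rw [← pow_mul, ← pow_mul, mul_assoc, mul_assoc, ← pow_add,
        show 6 * ((l : ℕ) * k) + i * k = k * (6 * l + i) by ring, mul_assoc]
    rw [Finset.sum_congr rfl fun k _ => e k, Finset.sum_comm]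
    simp only [← Finset.mul_sum, hζ.sum_fin_pow]
    rw [Finset.sum_eq_single i]
    · rw [if_pos (by omega)]; push_cast; ring
    · intro l _ hl
      rw [if_neg (by intro hd; apply hl; ext; omega), mul_zero]
    · simp
  · rw [norm_mul]
    have : ‖∑ l : Fin 7, h l * ζ ^ (6 * l * k : ℕ)‖ ≤ ∑ l : Fin 7, ‖h‖ := by
      refine (norm_sum_le _ _).trans (Finset.sum_le_sum fun l _ => ?_)
      rw [norm_mul, norm_pow, hζ.norm'_eq_one (by norm_num), one_pow, mul_one]
      exact norm_le_pi_norm h l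
    simp at this
    norm_num; linarith
  · simp [hζ.conj_pow_eq]

/-- Parseval: the cross terms vanish by orthogonality of characters. -/
theorem IsPrimitiveRoot.sum_norm_sq (hζ : IsPrimitiveRoot ζ 7) (b : Fin 7 → ℂ) :
    ∑ i : Fin 7, ‖∑ k, b k * (ζ ^ (i : ℕ)) ^ (k : ℕ)‖ ^ 2 = 7 * ∑ k, ‖b k‖ ^ 2 := by
  have e : ∀ i : Fin 7, ((‖∑ k, b k * (ζ ^ (i : ℕ)) ^ (k : ℕ)‖ ^ 2 : ℝ) : ℂ) =
      ∑ k, ∑ l, b k * starRingEnd ℂ (b l) * (ζ ^ (i : ℕ)) ^ (k + 6 * l : ℕ) := by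
    intro i
    rw [← Complex.normSq_eq_norm_sq, ← Complex.mul_conj, map_sum, Finset.sum_mul_sum]
    refine Finset.sum_congr rfl fun k _ => Finset.sum_congr rfl fun l _ => ?_
    rw [map_mul, ← pow_mul, ← pow_mul, ← pow_mul, hζ.conj_pow_eq, mul_mul_mul_comm, ← pow_add,
      show (i : ℕ) * k + 6 * (i * l) = i * (k + 6 * l) by ring]
  apply Complex.ofReal_injective
  rw [Complex.ofReal_sum, Finset.sum_congr rfl fun i _ => e i, Finset.sum_comm]
  push_cast
  rw [Finset.mul_sum]
  refine Finset.sum_congr rfl fun k _ => ?_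
  rw [Finset.sum_comm]
  simp only [← Finset.mul_sum, hζ.sum_fin_pow]
  rw [Finset.sum_eq_single k]
  · rw [if_pos (by omega), Complex.mul_conj, Complex.normSq_eq_norm_sq]; push_cast; ring
  · intro l _ hl
    rw [if_neg (by intro hd; apply hl; ext; omega), mul_zero]
  · simp

end FiniteFourier

/-! ### The strict maximum on a slice -/

/-- The Hamiltonian amended by the angular impulse, up to normalisation: a conserved quantity
having the regular heptagon of unit radius about the origin as a critical point. -/
noncomputable def amendedEnergy (z : Fin 7 → ℂ) : ℝ :=
  ∑ i, ∑ j ∈ Finset.Ioi i, Real.log (‖z i - z j‖ ^ 2) - 3 * ∑ i, ‖z i‖ ^ 2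

open IsSeventhRoots in
/-- The regular heptagon is a strict local maximum of the amended energy on a slice transverse to
the rotations. -/
theorem IsPrimitiveRoot.amendedEnergy_lt_of_slice {ζ : ℂ} (hζ : IsPrimitiveRoot ζ 7)
    {h : Fin 7 → ℂ} (hh : ‖h‖ ≤ 10⁻¹ ^ 11) (h0 : h ≠ 0)
    (him : (∑ i : Fin 7, h i * starRingEnd ℂ (ζ ^ (i : ℕ))).im = 0) :
    amendedEnergy (fun i => ζ ^ (i : ℕ) + h i) < amendedEnergy (fun i => ζ ^ (i : ℕ)) := by
  obtain ⟨a, ha, han, ha1⟩ := hζ.exists_fourier_coeff h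
  have hX := of_primitiveRoot hζ
  set X : Fin 7 → ℂ := fun i => ζ ^ (i : ℕ) with hXdef
  have hXi : ∀ i : Fin 7, ζ ^ (i : ℕ) = X i := fun _ => rfl
  simp only [hXi] at ha ha1 him ⊢
  have hXn : ∀ i, ‖X i‖ = 1 := fun i => by
    rw [← hXi, norm_pow, hζ.norm'_eq_one (by norm_num), one_pow]
  -- The infinitesimal rotation is the imaginary direction of mode 1, so the slice condition makes
  -- `a 1` real.
  have hr : a 1 = ((a 1).re : ℂ) := by
    apply Complex.ext
    · simp
    · rw [ha1]
      have : (7⁻¹ : ℂ) = ((7⁻¹ : ℝ) : ℂ) := by norm_num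
      rw [this, Complex.im_ofReal_mul, him]; simp
  set r := (a 1).re with hrdef
  -- `e` is the deviation from the kernel `a 4 = conj (a 5)` of the Hessian on the slice.
  set e : ℂ := a 4 - starRingEnd ℂ (a 5) with he
  have hae : starRingEnd ℂ (a 5) + e = a 4 := by rw [he]; ring
  set D : Fin 7 → Fin 7 → ℂ := fun m i => starRingEnd ℂ (a 5) * geom 4 (X m) * X i ^ 3 +
    a 5 * geom 5 (X m) * X i ^ 4 with hD
  set E : Fin 7 → Fin 7 → ℂ := fun m i => r + a 2 * geom 2 (X m) * X i +
    a 3 * geom 3 (X m) * X i ^ 2 + e * geom 4 (X m) * X i ^ 3 + a 6 * geom 6 (X m) * X i ^ 5 with hE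
  have hδ : ∀ k, ‖a k‖ ≤ 10⁻¹ ^ 10 := fun k => (han k).trans (hh.trans (by norm_num))
  obtain ⟨hne, hle⟩ := hX.sum_log_le hXn (a₀ := a 0) le_rfl
    ((Complex.abs_re_le_norm (a 1)).trans (hδ 1)) (hδ 2) (hδ 3) (e := e)
    (by
      have h4 := (han 4).trans hh
      have h5 := (han 5).trans hh
      refine (norm_sub_le _ _).trans ?_
      rw [Complex.norm_conj]
      norm_num at h4 h5 ⊢; linarith) (hδ 6) (hδ 5) (D := D) (E := E) (fun _ _ => rfl)
      (fun _ _ => rfl)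
  -- Divide `X i ^ k * (1 - X m ^ k)` by `X i * (1 - X m)`; mode 0 is a translation and drops out.
  have hdiff : ∀ i m, (X i + h i) - (X (i + m) + h (i + m)) =
      (X i - X (i + m)) * (1 + (D m i + E m i)) := by
    intro i m
    have : D m i + E m i = a 1 + a 2 * geom 2 (X m) * X i + a 3 * geom 3 (X m) * X i ^ 2 +
        a 4 * geom 4 (X m) * X i ^ 3 + a 5 * geom 5 (X m) * X i ^ 4 +
        a 6 * geom 6 (X m) * X i ^ 5 := by
      rw [hr, ← hae]; simp only [hD, hE]; ring
    rw [this, ha i, ha (i + m), hX.add]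
    simp only [Fin.sum_univ_seven, geom, Finset.sum_range_succ, Finset.sum_range_zero]
    simp only [show ((0 : Fin 7) : ℕ) = 0 from rfl, show ((1 : Fin 7) : ℕ) = 1 from rfl,
      show ((2 : Fin 7) : ℕ) = 2 from rfl, show ((3 : Fin 7) : ℕ) = 3 from rfl,
      show ((4 : Fin 7) : ℕ) = 4 from rfl, show ((5 : Fin 7) : ℕ) = 5 from rfl,
      show ((6 : Fin 7) : ℕ) = 6 from rfl]
    ring
  have hXne : ∀ i m, m ∈ ({0}ᶜ : Finset (Fin 7)) → X i - X (i + m) ≠ 0 := by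
    intro i m hm h0
    have := hζ.pow_inj i.2 (i + m).2 (sub_eq_zero.1 h0)
    have h2 : i = i + m := Fin.ext this
    simp at hm
    exact hm (by simpa using h2)
  have hlog : ∑ i, ∑ j ∈ Finset.Ioi i, Real.log (‖(X i + h i) - (X j + h j)‖ ^ 2) =
      ∑ i, ∑ j ∈ Finset.Ioi i, Real.log (‖X i - X j‖ ^ 2) +
      ∑ m ∈ ({0}ᶜ : Finset (Fin 7)), ∑ i, Real.log ‖1 + (D m i + E m i)‖ := by
    rw [Fin.sum_sum_Ioi_eq (fun i j => Real.log (‖(X i + h i) - (X j + h j)‖ ^ 2))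
      (fun i j => by rw [norm_sub_rev]), Fin.sum_sum_Ioi_eq (fun i j => Real.log (‖X i - X j‖ ^ 2))
      (fun i j => by rw [norm_sub_rev])]
    have : ∀ m ∈ ({0}ᶜ : Finset (Fin 7)), ∑ i, Real.log (‖(X i + h i) - (X (i + m) + h (i + m))‖ ^ 2) =
        ∑ i, Real.log (‖X i - X (i + m)‖ ^ 2) + 2 * ∑ i, Real.log ‖1 + (D m i + E m i)‖ := by
      intro m hm
      rw [Finset.mul_sum, ← Finset.sum_add_distrib]
      refine Finset.sum_congr rfl fun i _ => ?_
      rw [hdiff, norm_mul, mul_pow, Real.log_mul (pow_ne_zero _ (norm_ne_zero_iff.2 (hXne i m hm)))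
        (pow_ne_zero _ (norm_ne_zero_iff.2 (hne m i)))]
      simp [Real.log_pow]
    rw [Finset.sum_congr rfl this, Finset.sum_add_distrib, ← Finset.mul_sum]; ring
  have hsq : ∑ i, ‖X i + h i‖ ^ 2 - ∑ i, ‖X i‖ ^ 2 = 7 * (2 * r + (r ^ 2 + ‖a 0‖ ^ 2 + ‖a 2‖ ^ 2 +
      ‖a 3‖ ^ 2 + ‖a 4‖ ^ 2 + ‖a 5‖ ^ 2 + ‖a 6‖ ^ 2)) := by
    -- The heptagon itself is mode 1 with coefficient 1.
    have e1 : ∀ i, X i + h i = ∑ k, (a k + if k = 1 then 1 else 0) * X i ^ (k : ℕ) := by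
      intro i
      simp only [add_mul, Finset.sum_add_distrib, ← ha i]
      simp [add_comm]
    have e2 := hζ.sum_norm_sq fun k => a k + if k = 1 then 1 else 0
    simp only [hXi, ← e1] at e2
    rw [e2]
    simp only [hXn, Fin.sum_univ_seven]
    have : ‖a 1 + 1‖ ^ 2 = (r + 1) ^ 2 := by
      rw [hr]; norm_cast; rw [Real.norm_eq_abs, sq_abs]
    simp [Fin.ext_iff] at this ⊢
    rw [this]; ring
  unfold amendedEnergy
  rw [hlog]
  rw [hae] at hle
  have hpos : 0 < r ^ 2 + ‖a 0‖ ^ 2 + ‖a 2‖ ^ 2 + ‖a 3‖ ^ 2 + ‖e‖ ^ 2 + ‖a 6‖ ^ 2 + ‖a 5‖ ^ 4 := by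
    by_contra hcon
    apply h0
    have p1 := sq_nonneg r
    have p2 := sq_nonneg ‖a 0‖
    have p3 := sq_nonneg ‖a 2‖
    have p4 := sq_nonneg ‖a 3‖
    have p5 := sq_nonneg ‖e‖
    have p6 := sq_nonneg ‖a 6‖
    have p7 : 0 ≤ ‖a 5‖ ^ 4 := by positivity
    have q1 : r = 0 := pow_eq_zero_iff (two_ne_zero) |>.1 (by linarith)
    have q2 : a 0 = 0 := norm_eq_zero.1 (pow_eq_zero_iff (two_ne_zero) |>.1 (by linarith))
    have q3 : a 2 = 0 := norm_eq_zero.1 (pow_eq_zero_iff (two_ne_zero) |>.1 (by linarith))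
    have q4 : a 3 = 0 := norm_eq_zero.1 (pow_eq_zero_iff (two_ne_zero) |>.1 (by linarith))
    have q5 : e = 0 := norm_eq_zero.1 (pow_eq_zero_iff (two_ne_zero) |>.1 (by linarith))
    have q6 : a 6 = 0 := norm_eq_zero.1 (pow_eq_zero_iff (two_ne_zero) |>.1 (by linarith))
    have q7 : a 5 = 0 := norm_eq_zero.1 (pow_eq_zero_iff (four_ne_zero) |>.1 (by linarith))
    have q8 : a 4 = 0 := by rw [← hae, q5, q7]; simp
    have q9 : a 1 = 0 := by rw [hr, q1]; simp
    funext i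
    rw [ha i]
    simp [Fin.sum_univ_seven, q2, q3, q4, q6, q7, q8, q9]
  linarith

/-! ### The differential of the Hamiltonian and the conserved quantities -/

open scoped InnerProductSpace in
theorem hasFDerivAt_log_norm_sub_sq {n : ℕ} {z : Fin n → ℂ} {i j : Fin n} (h : z i ≠ z j) :
    HasFDerivAt (fun z : Fin n → ℂ => Real.log (‖z i - z j‖ ^ 2))
      ((‖z i - z j‖ ^ 2)⁻¹ • (2 • (innerSL ℝ (z i - z j)).comp
        (ContinuousLinearMap.proj (R := ℝ) (φ := fun _ : Fin n => ℂ) i -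
          ContinuousLinearMap.proj (R := ℝ) (φ := fun _ : Fin n => ℂ) j))) z := by
  have h1 : HasFDerivAt (fun z : Fin n → ℂ => z i - z j)
      (ContinuousLinearMap.proj (R := ℝ) (φ := fun _ : Fin n => ℂ) i -
          ContinuousLinearMap.proj (R := ℝ) (φ := fun _ : Fin n => ℂ) j) z :=
    (ContinuousLinearMap.proj (R := ℝ) (φ := fun _ : Fin n => ℂ) i -
          ContinuousLinearMap.proj (R := ℝ) (φ := fun _ : Fin n => ℂ) j).hasFDerivAt
  exact h1.norm_sq.log (pow_ne_zero _ (norm_ne_zero_iff.2 (sub_ne_zero.2 h)))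

theorem differentiableAt_vortexHamiltonian {n : ℕ} (κ : ℝ) {z : Fin n → ℂ}
    (hz : z ∈ vortexPhaseSpace n) : DifferentiableAt ℝ (vortexHamiltonian κ) z := by
  unfold vortexHamiltonian
  refine DifferentiableAt.const_mul ?_ _
  refine DifferentiableAt.fun_sum fun i _ => DifferentiableAt.fun_sum fun j hj => ?_
  exact (hasFDerivAt_log_norm_sub_sq (hz.ne (Finset.mem_Ioi.1 hj).ne)).differentiableAt

open scoped InnerProductSpace in
theorem fderiv_vortexHamiltonian {n : ℕ} (κ : ℝ) {z : Fin n → ℂ} (hz : z ∈ vortexPhaseSpace n)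
    (v : Fin n → ℂ) :
    fderiv ℝ (vortexHamiltonian κ) z v = -(κ ^ 2 / (4 * Real.pi)) *
      ∑ i, ∑ j ∈ Finset.Ioi i, (‖z i - z j‖ ^ 2)⁻¹ * (2 * ⟪z i - z j, v i - v j⟫_ℝ) := by
  have h : HasFDerivAt (vortexHamiltonian κ) (-(κ ^ 2 / (4 * Real.pi)) •
      ∑ i, ∑ j ∈ Finset.Ioi i, (‖z i - z j‖ ^ 2)⁻¹ • (2 • (innerSL ℝ (z i - z j)).comp
        (ContinuousLinearMap.proj (R := ℝ) (φ := fun _ : Fin n => ℂ) i -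
          ContinuousLinearMap.proj (R := ℝ) (φ := fun _ : Fin n => ℂ) j))) z := by
    unfold vortexHamiltonian
    refine HasFDerivAt.const_mul ?_ _
    refine HasFDerivAt.fun_sum fun i _ => HasFDerivAt.fun_sum fun j hj => ?_
    exact hasFDerivAt_log_norm_sub_sq (hz.ne (Finset.mem_Ioi.1 hj).ne)
  rw [h.fderiv]
  simp only [_root_.smul_apply, _root_.sum_apply,
    ContinuousLinearMap.comp_apply, _root_.sub_apply, ContinuousLinearMap.proj_apply,
    innerSL_apply_apply, smul_eq_mul, nsmul_eq_mul, Nat.cast_ofNat]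

theorem isOpen_vortexPhaseSpace (n : ℕ) : IsOpen (vortexPhaseSpace n) := by
  have : vortexPhaseSpace n = ⋂ i : Fin n, ⋂ j : Fin n, {z | i ≠ j → z i ≠ z j} := by
    ext z
    simp only [vortexPhaseSpace, Set.mem_ofPred_eq, Set.mem_iInter]
    exact ⟨fun h i j hij => h.ne hij, fun h i j hij => by_contra fun hne => h i j hne hij⟩
  rw [this]
  refine isOpen_iInter_of_finite fun i => isOpen_iInter_of_finite fun j => ?_
  by_cases hij : i = j
  · simp [hij]
  · simpa [hij] using isOpen_ne_fun (continuous_apply i) (continuous_apply j)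

theorem vortexSymplecticForm_self {n : ℕ} (κ : ℝ) (u : Fin n → ℂ) :
    vortexSymplecticForm κ u u = 0 :=
  Finset.sum_eq_zero fun j _ => by ring

open scoped InnerProductSpace in
theorem vortexSymplecticForm_I_mul_right {n : ℕ} (κ : ℝ) (u v : Fin n → ℂ) :
    vortexSymplecticForm κ u (fun j => Complex.I * v j) = 2 * κ * ∑ j, ⟪v j, u j⟫_ℝ := by
  unfold vortexSymplecticForm
  rw [Finset.mul_sum]
  refine Finset.sum_congr rfl fun j _ => ?_
  rw [Complex.inner]
  simp; ring

open scoped InnerProductSpace in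
theorem vortexSymplecticForm_I_mul_left {n : ℕ} (κ : ℝ) (u v : Fin n → ℂ) :
    vortexSymplecticForm κ (fun j => Complex.I * u j) v = -(2 * κ) * ∑ j, ⟪u j, v j⟫_ℝ := by
  unfold vortexSymplecticForm
  rw [Finset.mul_sum]
  refine Finset.sum_congr rfl fun j _ => ?_
  rw [Complex.inner]
  simp; ring

/-- Rotations about a point preserve the Hamiltonian. -/
theorem fderiv_vortexHamiltonian_rotation {n : ℕ} (κ : ℝ) {z : Fin n → ℂ}
    (hz : z ∈ vortexPhaseSpace n) (c : ℂ) :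
    fderiv ℝ (vortexHamiltonian κ) z (fun j => Complex.I * (z j - c)) = 0 := by
  rw [fderiv_vortexHamiltonian κ hz, Finset.sum_eq_zero, mul_zero]
  refine fun i _ => Finset.sum_eq_zero fun j _ => ?_
  have : Complex.I * (z i - c) - Complex.I * (z j - c) = Complex.I * (z i - z j) := by ring
  rw [this, Complex.inner]
  simp; right; ring

open scoped InnerProductSpace in
theorem hasFDerivAt_sum_norm_sub_sq {n : ℕ} (c : ℂ) (z : Fin n → ℂ) :
    HasFDerivAt (fun z : Fin n → ℂ => ∑ i, ‖z i - c‖ ^ 2)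
      (∑ i, 2 • (innerSL ℝ (z i - c)).comp
        (ContinuousLinearMap.proj (R := ℝ) (φ := fun _ : Fin n => ℂ) i)) z := by
  refine HasFDerivAt.fun_sum fun i _ => ?_
  have h1 : HasFDerivAt (fun z : Fin n → ℂ => z i - c)
      (ContinuousLinearMap.proj (R := ℝ) (φ := fun _ : Fin n => ℂ) i) z :=
    (ContinuousLinearMap.proj (R := ℝ) (φ := fun _ : Fin n => ℂ) i).hasFDerivAt.sub_const c
  exact h1.norm_sq

section Conservation

variable {n : ℕ} {κ : ℝ} {γ : ℝ → Fin n → ℂ} {γ' : Fin n → ℂ} {t : ℝ}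

theorem hasDerivAt_vortexHamiltonian_comp (hγ : HasDerivAt γ γ' t) (hz : γ t ∈ vortexPhaseSpace n)
    (hH : ∀ v, vortexSymplecticForm κ γ' v = fderiv ℝ (vortexHamiltonian κ) (γ t) v) :
    HasDerivAt (fun s => vortexHamiltonian κ (γ s)) 0 t := by
  have h := (differentiableAt_vortexHamiltonian κ hz).hasFDerivAt.comp_hasDerivAt t hγ
  rwa [← hH, vortexSymplecticForm_self] at h

/-- Noether's theorem: Hamilton's equations are tested on the generator `I * (z - c)` of rotations
about `c`, which annihilates `dH`. -/
theorem hasDerivAt_sum_norm_sub_sq_comp (hκ : κ ≠ 0) (hγ : HasDerivAt γ γ' t)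
    (hz : γ t ∈ vortexPhaseSpace n)
    (hH : ∀ v, vortexSymplecticForm κ γ' v = fderiv ℝ (vortexHamiltonian κ) (γ t) v) (c : ℂ) :
    HasDerivAt (fun s => ∑ i, ‖γ s i - c‖ ^ 2) 0 t := by
  have h := (hasFDerivAt_sum_norm_sub_sq c (γ t)).comp_hasDerivAt t hγ
  have h1 := hH fun j => Complex.I * (γ t j - c)
  rw [fderiv_vortexHamiltonian_rotation κ hz, vortexSymplecticForm_I_mul_right] at h1
  have h2 := (mul_eq_zero.1 h1).resolve_left (by simpa using hκ)
  have h3 : (∑ i, 2 • (innerSL ℝ (γ t i - c)).comp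
      (ContinuousLinearMap.proj (R := ℝ) (φ := fun _ : Fin n => ℂ) i)) γ' = 0 := by
    simp only [_root_.sum_apply, _root_.smul_apply,
      ContinuousLinearMap.comp_apply, ContinuousLinearMap.proj_apply, innerSL_apply_apply]
    rw [← Finset.smul_sum, h2, smul_zero]
  rw [h3] at h
  exact h

end Conservation

/-! ### The regularised vortex field and its global solutions -/

/-- The velocity field of `n` identical point vortices, regularised at distances below `δ`. -/
noncomputable def regularizedVortexField {n : ℕ} (κ δ : ℝ) (z : Fin n → ℂ) : Fin n → ℂ := fun i =>
  Complex.I * (((κ / (4 * Real.pi) : ℝ) : ℂ) *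
    ∑ j, ((max ‖z i - z j‖ δ) ^ 2)⁻¹ • (z i - z j))

open scoped InnerProductSpace in
theorem sum_sum_inner_antisymm {n : ℕ} {g : Fin n → Fin n → ℂ} (hg : ∀ i j, g i j = -g j i)
    (v : Fin n → ℂ) :
    ∑ i, ∑ j, ⟪g i j, v i⟫_ℝ = ∑ i, ∑ j ∈ Finset.Ioi i, ⟪g i j, v i - v j⟫_ℝ := by
  have h3 : ∀ i : Fin n, ∑ j, ⟪g i j, v i⟫_ℝ
      = ∑ j ∈ Finset.Ioi i, ⟪g i j, v i⟫_ℝ + ∑ j ∈ Finset.Iio i, ⟪g i j, v i⟫_ℝ := by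
    intro i
    have h0 : g i i = 0 := by
      have := hg i i; exact self_eq_neg.1 this
    rw [← Finset.sum_union]
    · symm
      refine Finset.sum_subset (Finset.subset_univ _) fun j _ hj => ?_
      have : j = i := by simpa [eq_comm] using hj
      rw [this, h0, inner_zero_left]
    · exact Finset.disjoint_left.2 fun j hj hj' => by simp at hj hj'; exact absurd hj (not_lt.2 hj'.le)
  rw [Finset.sum_congr rfl fun i _ => h3 i, Finset.sum_add_distrib]
  have h1 : ∑ i, ∑ j ∈ Finset.Iio i, ⟪g i j, v i⟫_ℝ = ∑ i, ∑ j ∈ Finset.Ioi i, -⟪g i j, v j⟫_ℝ := by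
    rw [Finset.sum_comm' (t' := Finset.univ) (s' := fun j => Finset.Ioi j) (by simp)]
    refine Finset.sum_congr rfl fun i _ => Finset.sum_congr rfl fun j _ => ?_
    rw [hg j i, inner_neg_left]
  rw [h1, ← Finset.sum_add_distrib]
  refine Finset.sum_congr rfl fun i _ => ?_
  rw [← Finset.sum_add_distrib]
  exact Finset.sum_congr rfl fun j _ => by rw [inner_sub_right]; ring

/-- At separations of at least `δ` the cutoff is inactive; antisymmetry of the interaction turns the
double sum into the sum over pairs in `dH`. -/
theorem vortexSymplecticForm_regularizedVortexField {n : ℕ} (κ : ℝ) {δ : ℝ} {z : Fin n → ℂ}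
    (hz : z ∈ vortexPhaseSpace n) (hδ : ∀ i j, i ≠ j → δ ≤ ‖z i - z j‖) (v : Fin n → ℂ) :
    vortexSymplecticForm κ (regularizedVortexField κ δ z) v =
      fderiv ℝ (vortexHamiltonian κ) z v := by
  unfold regularizedVortexField
  rw [vortexSymplecticForm_I_mul_left, fderiv_vortexHamiltonian κ hz]
  have e : ∀ i, inner ℝ (((κ / (4 * Real.pi) : ℝ) : ℂ) *
      ∑ j, ((max ‖z i - z j‖ δ) ^ 2)⁻¹ • (z i - z j)) (v i) = κ / (4 * Real.pi) *
      ∑ j, inner ℝ (((max ‖z i - z j‖ δ) ^ 2)⁻¹ • (z i - z j)) (v i) := by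
    intro i
    rw [← Complex.real_smul, real_inner_smul_left, sum_inner]
  simp only [e]
  rw [← Finset.mul_sum, sum_sum_inner_antisymm (g := fun i j =>
    ((max ‖z i - z j‖ δ) ^ 2)⁻¹ • (z i - z j)) (fun i j => by
      rw [norm_sub_rev, ← smul_neg, neg_sub]), Finset.mul_sum, Finset.mul_sum, Finset.mul_sum]
  refine Finset.sum_congr rfl fun i _ => ?_
  rw [Finset.mul_sum, Finset.mul_sum, Finset.mul_sum]
  refine Finset.sum_congr rfl fun j hj => ?_
  rw [real_inner_smul_left, max_eq_left (hδ i j (Finset.mem_Ioi.1 hj).ne)]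
  ring

/-- A bounded Lipschitz autonomous vector field on a Banach space is complete. -/
theorem exists_global_solution {E : Type*} [NormedAddCommGroup E] [NormedSpace ℝ E]
    [CompleteSpace E] {F : E → E} {K L : NNReal} (hF : LipschitzWith K F) (hL : ∀ x, ‖F x‖ ≤ L)
    (x₀ : E) : ∃ γ : ℝ → E, γ 0 = x₀ ∧ ∀ t, HasDerivAt γ (F (γ t)) t := by
  have hloc : ∀ T : ℝ, 0 < T → ∃ α : ℝ → E, α 0 = x₀ ∧ ∀ t ∈ Set.Ioo (-T) T,
      HasDerivAt α (F (α t)) t := by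
    intro T hT
    -- Speed at most `L` cannot leave the ball of radius `L * T` within time `T`.
    have hPL : IsPicardLindelof (fun _ => F) (tmin := -T) (tmax := T) ⟨0, by constructor <;> linarith⟩ x₀
        (L * ⟨T, hT.le⟩) 0 L K := by
      refine ⟨fun _ _ => hF.lipschitzOnWith, fun _ _ => continuousOn_const, fun _ _ x _ => hL x, ?_⟩
      simp only [sub_zero, zero_sub, neg_neg, max_self, NNReal.coe_zero]
      exact le_rfl
    obtain ⟨α, h0, hα⟩ := hPL.exists_eq_forall_mem_Icc_hasDerivWithinAt₀
    exact ⟨α, h0, fun t ht => (hα t (Set.Ioo_subset_Icc_self ht)).hasDerivAt (Icc_mem_nhds ht.1 ht.2)⟩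
  choose! α hα0 hα using hloc
  have hagree : ∀ S T, 0 < S → S ≤ T → Set.EqOn (α S) (α T) (Set.Ioo (-S) S) := by
    intro S T hS hST
    refine ODE_solution_unique_of_mem_Ioo (v := fun _ => F) (s := fun _ => Set.univ) (K := K) (t₀ := 0)
      (fun _ _ => hF.lipschitzOnWith) ⟨by linarith, hS⟩ (fun t ht => ⟨hα S hS t ht, trivial⟩)
      (fun t ht => ⟨hα T (by linarith) t ⟨by linarith [ht.1], by linarith [ht.2]⟩, trivial⟩) ?_
    rw [hα0 S hS, hα0 T (by linarith)]
  -- The local solutions agree by uniqueness; near `t` all of them coincide with the one on the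
  -- interval of half-length `|t| + 2`.
  refine ⟨fun t => α (|t| + 1) t, hα0 _ (by positivity), fun t => ?_⟩
  have ht : t ∈ Set.Ioo (-(|t| + 1)) (|t| + 1) := by
    constructor <;> linarith [neg_abs_le t, le_abs_self t]
  have hT : 0 < |t| + 2 := by positivity
  have heq : ∀ s ∈ Set.Ioo (-(|t| + 1)) (|t| + 1), α (|s| + 1) s = α (|t| + 2) s := by
    intro s hs
    have hs' : |s| < |t| + 1 := abs_lt.2 ⟨hs.1, hs.2⟩
    exact hagree _ _ (by positivity) (by linarith)
      ⟨by linarith [neg_abs_le s], by linarith [le_abs_self s]⟩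
  have hd := hα _ hT t ⟨by linarith [ht.1], by linarith [ht.2]⟩
  rw [← heq t ht] at hd
  exact hd.congr_of_eventuallyEq (Filter.eventually_of_mem (Ioo_mem_nhds ht.1 ht.2) heq)

theorem norm_max_sq_inv_smul_le {δ : ℝ} (hδ : 0 < δ) (u : ℂ) :
    ‖((max ‖u‖ δ) ^ 2)⁻¹ • u‖ ≤ δ⁻¹ := by
  have hm : δ ≤ max ‖u‖ δ := le_max_right _ _
  have hm0 : 0 < max ‖u‖ δ := hδ.trans_le hm
  rw [norm_smul, norm_inv, norm_pow, Real.norm_of_nonneg hm0.le]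
  calc ((max ‖u‖ δ) ^ 2)⁻¹ * ‖u‖ ≤ ((max ‖u‖ δ) ^ 2)⁻¹ * max ‖u‖ δ := by
        gcongr; exact le_max_left _ _
    _ = (max ‖u‖ δ)⁻¹ := by field_simp
    _ ≤ _ := by gcongr

/-- Split off the variation of the weight; this leaves three terms, each at most `(δ ^ 2)⁻¹ * ‖u -
v‖`. -/
theorem norm_max_sq_inv_smul_sub_le {δ : ℝ} (hδ : 0 < δ) (u v : ℂ) :
    ‖((max ‖u‖ δ) ^ 2)⁻¹ • u - ((max ‖v‖ δ) ^ 2)⁻¹ • v‖ ≤ 3 * (δ ^ 2)⁻¹ * ‖u - v‖ := by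
  have hu : δ ≤ max ‖u‖ δ := le_max_right _ _
  have hv : δ ≤ max ‖v‖ δ := le_max_right _ _
  have hv' : ‖v‖ ≤ max ‖v‖ δ := le_max_left _ _
  have hlip : |max ‖v‖ δ - max ‖u‖ δ| ≤ ‖u - v‖ := by
    refine (abs_max_sub_max_le_abs _ _ _).trans ?_
    rw [norm_sub_rev]; exact abs_norm_sub_norm_le v u
  generalize max ‖u‖ δ = a at *
  generalize max ‖v‖ δ = b at *
  have ha : 0 < a := hδ.trans_le hu
  have hb : 0 < b := hδ.trans_le hv
  have e : (a ^ 2)⁻¹ • u - (b ^ 2)⁻¹ • v = (a ^ 2)⁻¹ • (u - v) + ((a ^ 2)⁻¹ - (b ^ 2)⁻¹) • v := by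
    rw [smul_sub, sub_smul]; abel
  have e2 : (a ^ 2)⁻¹ - (b ^ 2)⁻¹ = (b - a) * (a + b) * ((a ^ 2)⁻¹ * (b ^ 2)⁻¹) := by
    field_simp; ring
  rw [e]
  refine (norm_add_le _ _).trans ?_
  rw [norm_smul, norm_smul, e2, norm_mul, norm_mul, Real.norm_eq_abs, Real.norm_eq_abs,
    Real.norm_eq_abs, Real.norm_eq_abs, abs_of_pos (by positivity : 0 < a + b),
    abs_of_pos (by positivity : 0 < (a ^ 2)⁻¹), abs_of_pos (by positivity : 0 < (a ^ 2)⁻¹ * (b ^ 2)⁻¹)]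
  have hn := norm_nonneg (u - v)
  calc _ ≤ (a ^ 2)⁻¹ * ‖u - v‖ + ‖u - v‖ * (a + b) * ((a ^ 2)⁻¹ * (b ^ 2)⁻¹) * b := by gcongr
    _ = ((a ^ 2)⁻¹ + (a⁻¹ * b⁻¹ + (a ^ 2)⁻¹)) * ‖u - v‖ := by field_simp
    _ ≤ ((δ ^ 2)⁻¹ + (δ⁻¹ * δ⁻¹ + (δ ^ 2)⁻¹)) * ‖u - v‖ := by gcongr
    _ = _ := by field_simp; ring

theorem norm_regularizedVortexField_le {n : ℕ} (κ : ℝ) {δ : ℝ} (hδ : 0 < δ) (z : Fin n → ℂ) :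
    ‖regularizedVortexField κ δ z‖ ≤ |κ / (4 * Real.pi)| * (n * δ⁻¹) := by
  refine (pi_norm_le_iff_of_nonneg (by positivity)).2 fun i => ?_
  rw [regularizedVortexField, norm_mul, norm_mul, Complex.norm_I, one_mul, Complex.norm_real,
    Real.norm_eq_abs]
  gcongr
  refine (norm_sum_le _ _).trans ((Finset.sum_le_sum fun j _ =>
    norm_max_sq_inv_smul_le hδ (z i - z j)).trans ?_)
  simp

theorem lipschitzWith_regularizedVortexField {n : ℕ} (κ : ℝ) {δ : ℝ} (hδ : 0 < δ) :
    LipschitzWith (Real.toNNReal (|κ / (4 * Real.pi)| * (n * (3 * (δ ^ 2)⁻¹ * 2))))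
      (regularizedVortexField (n := n) κ δ) := by
  refine LipschitzWith.of_dist_le_mul fun z z' => ?_
  rw [Real.coe_toNNReal _ (by positivity), dist_eq_norm, dist_eq_norm]
  refine (pi_norm_le_iff_of_nonneg (by positivity)).2 fun i => ?_
  rw [Pi.sub_apply, regularizedVortexField, regularizedVortexField, ← mul_sub, ← mul_sub, norm_mul,
    norm_mul, Complex.norm_I, one_mul, Complex.norm_real, Real.norm_eq_abs, mul_assoc,
    ← Finset.sum_sub_distrib]
  gcongr
  have hij : ∀ j, ‖((max ‖z i - z j‖ δ) ^ 2)⁻¹ • (z i - z j) -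
      ((max ‖z' i - z' j‖ δ) ^ 2)⁻¹ • (z' i - z' j)‖ ≤ 3 * (δ ^ 2)⁻¹ * 2 * ‖z - z'‖ := by
    intro j
    refine (norm_max_sq_inv_smul_sub_le hδ _ _).trans ?_
    rw [mul_assoc _ 2]
    gcongr
    rw [show z i - z j - (z' i - z' j) = (z - z') i - (z - z') j by simp; ring]
    refine (norm_sub_le _ _).trans ?_
    linarith [norm_le_pi_norm (z - z') i, norm_le_pi_norm (z - z') j]
  refine (norm_sum_le _ _).trans ((Finset.sum_le_sum fun j _ => hij j).trans ?_)
  simp [mul_assoc]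

theorem exists_regularizedVortexField_solution {n : ℕ} (κ : ℝ) {δ : ℝ} (hδ : 0 < δ)
    (z : Fin n → ℂ) : ∃ γ : ℝ → Fin n → ℂ, γ 0 = z ∧
      ∀ t, HasDerivAt γ (regularizedVortexField κ δ (γ t)) t :=
  exists_global_solution (lipschitzWith_regularizedVortexField κ hδ)
    (L := ⟨|κ / (4 * Real.pi)| * (n * δ⁻¹), by positivity⟩)
    (norm_regularizedVortexField_le κ hδ) z

/-! ### Stability from a strict maximum -/

/-- A compact set on which a function attains strictly its maximum over a neighbourhood is stable
for all curves along which the function is conserved. -/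
theorem exists_stable_superlevel {E : Type*} [PseudoMetricSpace E] [ProperSpace E] {O : Set E}
    (hO : IsCompact O) {K : E → ℝ} {ε k₀ : ℝ} (hε : 0 < ε)
    (hK : ContinuousOn K (Metric.cthickening ε O))
    (hlt : ∀ z ∈ Metric.cthickening ε O, z ∉ O → K z < k₀) :
    ∃ k < k₀, ∀ γ : ℝ → E, Continuous γ →
      (∀ t, γ t ∈ Metric.thickening ε O → HasDerivAt (fun s => K (γ s)) 0 t) →
      γ 0 ∈ Metric.thickening ε O → k < K (γ 0) → ∀ t, γ t ∈ Metric.thickening ε O ∧ k < K (γ t) := by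
  have hcomp : IsCompact (Metric.cthickening ε O \ Metric.thickening ε O) :=
    hO.cthickening.diff Metric.isOpen_thickening
  have hOt : O ⊆ Metric.thickening ε O := Metric.self_subset_thickening hε O
  -- `k` is the maximum of `K` on the compact shell bounding the tube, or any value below `k₀` if
  -- the shell is empty.
  obtain ⟨k, hk, hkb⟩ : ∃ k < k₀, ∀ z ∈ Metric.cthickening ε O \ Metric.thickening ε O, K z ≤ k := by
    rcases (Metric.cthickening ε O \ Metric.thickening ε O).eq_empty_or_nonempty with h | h
    · exact ⟨k₀ - 1, by linarith, by simp [h]⟩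
    · obtain ⟨x, hx, hmax⟩ := hcomp.exists_isMaxOn h (hK.mono Set.sdiff_subset)
      exact ⟨K x, hlt x hx.1 fun hxO => hx.2 (hOt hxO), fun z hz => hmax hz⟩
  refine ⟨k, hk, fun γ hγ hd h0 hk0 => ?_⟩
  set S : Set ℝ := {t | γ t ∈ Metric.thickening ε O ∧ K (γ t) = K (γ 0)} with hS
  have hopen : IsOpen S := by
    rw [Metric.isOpen_iff]
    rintro t ⟨ht, hKt⟩
    obtain ⟨r, hr, hball⟩ := Metric.isOpen_iff.1 (Metric.isOpen_thickening.preimage hγ) t ht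
    refine ⟨r, hr, fun s hs => ⟨hball hs, ?_⟩⟩
    rw [← hKt]
    exact (convex_ball t r).is_const_of_fderivWithin_eq_zero (𝕜 := ℝ)
      (f := fun s => K (γ s))
      (fun u hu => (hd u (hball hu)).differentiableAt.differentiableWithinAt)
      (fun u hu => by
        rw [fderivWithin_of_isOpen Metric.isOpen_ball hu]
        ext; simpa using (hd u (hball hu)).deriv) hs (Metric.mem_ball_self hr)
  have hclosed : IsClosed S := by
    rw [← closure_subset_iff_isClosed]
    intro t ht
    have h1 : γ t ∈ Metric.cthickening ε O := by
      have : closure S ⊆ γ ⁻¹' Metric.cthickening ε O :=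
        closure_minimal (fun s hs => Metric.thickening_subset_cthickening _ _ hs.1)
          (Metric.isClosed_cthickening.preimage hγ)
      exact this ht
    have h2 : K (γ t) = K (γ 0) := by
      have hc : ContinuousWithinAt (fun s => K (γ s)) S t :=
        (hK (γ t) h1).comp hγ.continuousWithinAt
          fun s hs => Metric.thickening_subset_cthickening _ _ hs.1
      have := mem_closure_iff_nhdsWithin_neBot.1 ht
      refine tendsto_nhds_unique hc (tendsto_const_nhds.congr' ?_)
      filter_upwards [self_mem_nhdsWithin] with s hs using hs.2.symm
    -- A limit time outside the open tube would put the curve on the shell, where `K ≤ k`.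
    refine ⟨by_contra fun hn => ?_, h2⟩
    linarith [hkb _ ⟨h1, hn⟩]
  have huniv := IsClopen.eq_univ ⟨hclosed, hopen⟩ ⟨0, h0, rfl⟩
  intro t
  have : t ∈ S := huniv ▸ Set.mem_univ t
  exact ⟨this.1, this.2.symm ▸ hk0⟩

/-! ### The strict maximum modulo rotations -/

theorem amendedEnergy_circle_mul (u : Circle) (z : Fin 7 → ℂ) :
    amendedEnergy (fun i => u * z i) = amendedEnergy z := by
  unfold amendedEnergy
  simp only [← mul_sub, norm_mul, Circle.norm_coe, one_mul]

/-- The regular heptagon is a local maximum of the amended energy, strict modulo rotations. -/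
theorem IsPrimitiveRoot.eventually_amendedEnergy_lt {ζ : ℂ} (hζ : IsPrimitiveRoot ζ 7) :
    ∀ᶠ z in 𝓝 (fun i : Fin 7 => ζ ^ (i : ℕ)),
      (∃ u : Circle, z = fun i : Fin 7 => u * ζ ^ (i : ℕ)) ∨
        amendedEnergy z < amendedEnergy (fun i => ζ ^ (i : ℕ)) := by
  set X : Fin 7 → ℂ := fun i => ζ ^ (i : ℕ) with hX
  have hXX : ∑ i, X i * starRingEnd ℂ (X i) = 7 := by
    have : ∀ i, X i * starRingEnd ℂ (X i) = 1 := fun i => by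
      rw [Complex.mul_conj, Complex.normSq_eq_norm_sq, hX]
      simp [hζ.norm'_eq_one (by norm_num)]
    simp [this]
  set S : (Fin 7 → ℂ) → ℂ := fun z => ∑ i, z i * starRingEnd ℂ (X i) with hS
  have hSc : Continuous S := by fun_prop
  have hSX : S X = 7 := hXX
  -- `G z` is the phase that makes the overlap `S` real and positive, so `G z • z` lies in the
  -- slice.
  set G : (Fin 7 → ℂ) → ℂ := fun z => starRingEnd ℂ (S z) / ‖S z‖ with hG
  have hGX : G X = 1 := by
    simp only [hG, hSX, map_ofNat]
    norm_num
  have hS0 : S X ≠ 0 := by rw [hSX]; norm_num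
  have hGc : ContinuousAt G X := by
    refine ContinuousAt.div (by fun_prop) (by fun_prop) ?_
    simpa using hS0
  have hsm : Filter.Tendsto (fun z => ‖G z • z - X‖) (𝓝 X) (𝓝 0) := by
    have : ContinuousAt (fun z => ‖G z • z - X‖) X :=
      ((hGc.smul continuousAt_id).sub continuousAt_const).norm
    simpa [ContinuousAt, hGX] using this
  filter_upwards [hsm.eventually_le_const (show (0 : ℝ) < 10⁻¹ ^ 11 by positivity),
    hSc.continuousAt.eventually_ne hS0] with z hz hz0
  have hGn : ‖G z‖ = 1 := by
    rw [hG]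
    simp only [norm_div, Complex.norm_conj, Complex.norm_real, norm_norm]
    exact div_self (norm_ne_zero_iff.2 hz0)
  set u : Circle := ⟨G z, by simpa [Submonoid.unitSphere] using hGn⟩ with hu
  have huz : (u : ℂ) = G z := rfl
  by_cases h0 : G z • z - X = 0
  · left
    refine ⟨u⁻¹, ?_⟩
    funext i
    have := congrFun (sub_eq_zero.1 h0) i
    simp only [Pi.smul_apply, smul_eq_mul, ← huz] at this
    change z i = _ * X i
    rw [← this, Circle.coe_inv, inv_mul_cancel_left₀ (Circle.coe_ne_zero u)]
  · right
    have key := hζ.amendedEnergy_lt_of_slice hz h0 (by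
      have : ∑ i : Fin 7, (G z • z - X) i * starRingEnd ℂ (ζ ^ (i : ℕ)) = ((‖S z‖ - 7 : ℝ) : ℂ) := by
        have e : ∀ i : Fin 7, (G z • z - X) i * starRingEnd ℂ (ζ ^ (i : ℕ)) =
            G z * (z i * starRingEnd ℂ (X i)) - X i * starRingEnd ℂ (X i) := fun i => by
          simp only [Pi.sub_apply, Pi.smul_apply, smul_eq_mul, hX]; ring
        rw [Finset.sum_congr rfl fun i _ => e i, Finset.sum_sub_distrib, ← Finset.mul_sum, hXX]
        change G z * S z - 7 = _
        have hn : (‖S z‖ : ℂ) ≠ 0 := by simpa using hz0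
        have : G z * S z = ‖S z‖ := by
          rw [hG]
          simp only
          rw [div_mul_eq_mul_div, mul_comm, Complex.mul_conj, Complex.normSq_eq_norm_sq]
          push_cast
          field_simp
        rw [this]; push_cast; ring
      rw [this, Complex.ofReal_im])
    have e : (fun i : Fin 7 => ζ ^ (i : ℕ) + (G z • z - X) i) = fun i => u * z i := by
      funext i; simp [hX, huz]
    rw [e, amendedEnergy_circle_mul] at key
    exact key

/-! ### Rings of arbitrary centre and size -/

/-- The configurations obtained by rotating the regular heptagon with centre `c` and first vertex
`c + w` about its centre. -/
noncomputable def ringOrbit (c w : ℂ) : Set (Fin 7 → ℂ) :=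
  Set.range fun (u : Circle) (j : Fin 7) => c + u * (w * Complex.exp (2 * Real.pi * Complex.I / 7) ^ (j : ℕ))

/-- The amended energy relative to the regular heptagon with centre `c` and first vertex `c + w`. -/
noncomputable def ringEnergy (c w : ℂ) (z : Fin 7 → ℂ) : ℝ :=
  amendedEnergy fun i => (z i - c) / w

theorem isPrimitiveRoot_exp_seven :
    IsPrimitiveRoot (Complex.exp (2 * Real.pi * Complex.I / 7)) 7 := by
  simpa using Complex.isPrimitiveRoot_exp 7 (by norm_num)

theorem isCompact_ringOrbit (c w : ℂ) : IsCompact (ringOrbit c w) :=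
  isCompact_range (continuous_pi fun j => by fun_prop)

theorem ringOrbit_subset_vortexPhaseSpace (c : ℂ) {w : ℂ} (hw : w ≠ 0) :
    ringOrbit c w ⊆ vortexPhaseSpace 7 := by
  rintro _ ⟨u, rfl⟩ i j hij
  have h1 := mul_left_cancel₀ hw (mul_left_cancel₀ (Circle.coe_ne_zero u) (add_left_cancel hij))
  exact Fin.ext (isPrimitiveRoot_exp_seven.pow_inj i.2 j.2 h1)

theorem ringEnergy_of_mem_ringOrbit {c w : ℂ} (hw : w ≠ 0) {z : Fin 7 → ℂ}
    (hz : z ∈ ringOrbit c w) : ringEnergy c w z =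
      amendedEnergy fun i => Complex.exp (2 * Real.pi * Complex.I / 7) ^ (i : ℕ) := by
  obtain ⟨u, rfl⟩ := hz
  rw [ringEnergy, ← amendedEnergy_circle_mul u fun i : Fin 7 =>
    Complex.exp (2 * Real.pi * Complex.I / 7) ^ (i : ℕ)]
  congr 1; funext i
  field_simp
  ring

theorem planeMotion_mem_ringOrbit {c w : ℂ} (a : Circle) {z : Fin 7 → ℂ} (hz : z ∈ ringOrbit c w) :
    planeMotion a (c - a * c) z ∈ ringOrbit c w := by
  obtain ⟨u, rfl⟩ := hz
  refine ⟨a * u, ?_⟩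
  funext j
  simp only [planeMotion, Circle.coe_mul]; ring

theorem ringEnergy_planeMotion (c w : ℂ) (a : Circle) (z : Fin 7 → ℂ) :
    ringEnergy c w (planeMotion a (c - a * c) z) = ringEnergy c w z := by
  rw [ringEnergy, ringEnergy, ← amendedEnergy_circle_mul a fun i => (z i - c) / w]
  congr 1; funext i
  simp only [planeMotion]; ring

theorem dist_planeMotion {n : ℕ} (a : Circle) (b : ℂ) (z z' : Fin n → ℂ) :
    dist (planeMotion a b z) (planeMotion a b z') = dist z z' := by
  simp only [dist_pi_def]
  congr 2; funext i
  rw [← NNReal.coe_inj, coe_nndist, coe_nndist, dist_eq_norm, dist_eq_norm, planeMotion, planeMotion,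
    add_sub_add_right_eq_sub, ← mul_sub, norm_mul, Circle.norm_coe, one_mul]

/-- Rotations act transitively on the orbit and preserve distance and energy, so one radius,
rescaled by `‖w‖`, serves for the whole orbit. -/
theorem exists_cthickening_ringEnergy_lt (c : ℂ) {w : ℂ} (hw : w ≠ 0) :
    ∃ ε > 0, ∀ z ∈ Metric.cthickening ε (ringOrbit c w), z ∉ ringOrbit c w → ringEnergy c w z <
      amendedEnergy fun i => Complex.exp (2 * Real.pi * Complex.I / 7) ^ (i : ℕ) := by
  obtain ⟨r, hr, hball⟩ := Metric.eventually_nhds_iff.1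
    isPrimitiveRoot_exp_seven.eventually_amendedEnergy_lt
  have hw' : 0 < ‖w‖ := norm_pos_iff.2 hw
  have hε : 0 < r * ‖w‖ := by positivity
  refine ⟨r * ‖w‖ / 2, by positivity, fun z hz hzO => ?_⟩
  obtain ⟨_, ⟨u, rfl⟩, hd⟩ := Metric.mem_thickening_iff.1
    (Metric.cthickening_subset_thickening' hε (by linarith) _ hz)
  have hu := Circle.coe_ne_zero u
  have hz' := hball (y := fun i => (u⁻¹ : Circle) * ((z i - c) / w)) (by
    rw [dist_pi_lt_iff hr]
    intro i
    have hi := (dist_pi_lt_iff hε).1 hd i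
    rw [dist_eq_norm] at hi ⊢
    have e : z i - (c + u * (w * Complex.exp (2 * Real.pi * Complex.I / 7) ^ (i : ℕ))) =
        u * w * ((u⁻¹ : Circle) * ((z i - c) / w) -
          Complex.exp (2 * Real.pi * Complex.I / 7) ^ (i : ℕ)) := by
      rw [Circle.coe_inv]; field_simp; ring
    rw [e, norm_mul, norm_mul, Circle.norm_coe, one_mul, mul_comm] at hi
    exact lt_of_mul_lt_mul_right hi hw'.le)
  rw [amendedEnergy_circle_mul] at hz'
  refine hz'.resolve_left ?_
  rintro ⟨u', hu'⟩
  refine hzO ⟨u * u', ?_⟩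
  funext i
  have := congrFun hu' i
  have h : z i - c = w * (u * (u' * Complex.exp (2 * Real.pi * Complex.I / 7) ^ (i : ℕ))) := by
    rw [← this, Circle.coe_inv]; field_simp
  simp only [Circle.coe_mul]
  linear_combination -h

/-- Off collisions, the energy is a combination of the two conserved quantities and a constant. -/
theorem ringEnergy_eq {κ : ℝ} (hκ : κ ≠ 0) (c : ℂ) {w : ℂ} (hw : w ≠ 0) {z : Fin 7 → ℂ}
    (hz : z ∈ vortexPhaseSpace 7) : ringEnergy c w z =
      -(4 * Real.pi / κ ^ 2) * vortexHamiltonian κ z - 3 / ‖w‖ ^ 2 * ∑ i, ‖z i - c‖ ^ 2 -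
        ∑ i : Fin 7, ∑ _j ∈ Finset.Ioi i, Real.log (‖w‖ ^ 2) := by
  have hw' : ‖w‖ ≠ 0 := norm_ne_zero_iff.2 hw
  have e1 : ∑ i, ∑ j ∈ Finset.Ioi i, Real.log (‖(z i - c) / w - (z j - c) / w‖ ^ 2) =
      ∑ i, ∑ j ∈ Finset.Ioi i, Real.log (‖z i - z j‖ ^ 2) -
        ∑ i : Fin 7, ∑ _j ∈ Finset.Ioi i, Real.log (‖w‖ ^ 2) := by
    rw [← Finset.sum_sub_distrib]
    refine Finset.sum_congr rfl fun i _ => ?_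
    rw [← Finset.sum_sub_distrib]
    refine Finset.sum_congr rfl fun j hj => ?_
    rw [← sub_div, sub_sub_sub_cancel_right, norm_div, div_pow, Real.log_div
      (pow_ne_zero _ (norm_ne_zero_iff.2 (sub_ne_zero.2 (hz.ne (Finset.mem_Ioi.1 hj).ne))))
      (pow_ne_zero _ hw')]
  have e2 : ∑ i, ‖(z i - c) / w‖ ^ 2 = (∑ i, ‖z i - c‖ ^ 2) / ‖w‖ ^ 2 := by
    rw [Finset.sum_div]
    exact Finset.sum_congr rfl fun i _ => by rw [norm_div, div_pow]
  rw [ringEnergy, amendedEnergy, e1, e2, vortexHamiltonian]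
  have := Real.pi_ne_zero
  field_simp
  ring

theorem continuousOn_ringEnergy (c : ℂ) {w : ℂ} (hw : w ≠ 0) :
    ContinuousOn (ringEnergy c w) (vortexPhaseSpace 7) := by
  -- `ringEnergy` does not involve the vorticity, so it may be computed with vorticity 1.
  have h : ContinuousOn (fun z => -(4 * Real.pi / (1 : ℝ) ^ 2) * vortexHamiltonian 1 z -
      3 / ‖w‖ ^ 2 * ∑ i, ‖z i - c‖ ^ 2 - ∑ i : Fin 7, ∑ _j ∈ Finset.Ioi i, Real.log (‖w‖ ^ 2))
      (vortexPhaseSpace 7) := by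
    have h1 : ContinuousOn (vortexHamiltonian (n := 7) 1) (vortexPhaseSpace 7) := fun z hz =>
      (differentiableAt_vortexHamiltonian 1 hz).continuousAt.continuousWithinAt
    fun_prop
  exact h.congr fun z hz => ringEnergy_eq one_ne_zero c hw hz

theorem hasDerivAt_ringEnergy_comp {κ : ℝ} (hκ : κ ≠ 0) (c : ℂ) {w : ℂ} (hw : w ≠ 0)
    {γ : ℝ → Fin 7 → ℂ} {γ' : Fin 7 → ℂ} {t : ℝ} (hγ : HasDerivAt γ γ' t)
    (hz : γ t ∈ vortexPhaseSpace 7)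
    (hH : ∀ v, vortexSymplecticForm κ γ' v = fderiv ℝ (vortexHamiltonian κ) (γ t) v) :
    HasDerivAt (fun s => ringEnergy c w (γ s)) 0 t := by
  have h := (((hasDerivAt_vortexHamiltonian_comp hγ hz hH).const_mul
    (-(4 * Real.pi / κ ^ 2))).sub ((hasDerivAt_sum_norm_sub_sq_comp hκ hγ hz hH c).const_mul
      (3 / ‖w‖ ^ 2))).sub_const (∑ i : Fin 7, ∑ _j ∈ Finset.Ioi i, Real.log (‖w‖ ^ 2))
  simp only [mul_zero, sub_zero] at h
  refine h.congr_of_eventuallyEq ?_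
  filter_upwards [hγ.continuousAt.preimage_mem_nhds
    ((isOpen_vortexPhaseSpace 7).mem_nhds hz)] with s hs
  exact ringEnergy_eq hκ c hw hs

/-- The heptagon is a critical point of the amended energy. -/
theorem fderiv_vortexHamiltonian_of_mem_ringOrbit {κ : ℝ} (hκ : κ ≠ 0) {c w : ℂ} (hw : w ≠ 0)
    {z : Fin 7 → ℂ} (hz : z ∈ ringOrbit c w) (v : Fin 7 → ℂ) :
    fderiv ℝ (vortexHamiltonian κ) z v =
      -(6 * κ ^ 2 / (4 * Real.pi * ‖w‖ ^ 2)) * ∑ i, inner ℝ (z i - c) (v i) := by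
  have hzP := ringOrbit_subset_vortexPhaseSpace c hw hz
  obtain ⟨ε, hε, hlt⟩ := exists_cthickening_ringEnergy_lt c hw
  -- The vanishing differential at the maximum gives `dH` without evaluating the velocity sums.
  have hmax : IsLocalMax (ringEnergy c w) z := by
    filter_upwards [Metric.isOpen_thickening.mem_nhds (Metric.self_subset_thickening hε _ hz)]
      with x hx
    rw [ringEnergy_of_mem_ringOrbit hw hz]
    by_cases hxO : x ∈ ringOrbit c w
    · exact (ringEnergy_of_mem_ringOrbit hw hxO).le
    · exact (hlt x (Metric.thickening_subset_cthickening _ _ hx) hxO).le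
  have hd := ((((differentiableAt_vortexHamiltonian κ hzP).hasFDerivAt.const_mul
    (-(4 * Real.pi / κ ^ 2))).sub ((hasFDerivAt_sum_norm_sub_sq c z).const_mul
      (3 / ‖w‖ ^ 2))).sub_const (∑ i : Fin 7, ∑ _j ∈ Finset.Ioi i, Real.log (‖w‖ ^ 2)))
  have hd' := hd.congr_of_eventuallyEq (f₁ := ringEnergy c w) (by
    filter_upwards [(isOpen_vortexPhaseSpace 7).mem_nhds hzP] with x hx
    exact ringEnergy_eq hκ c hw hx)
  have h0 := congrArg (fun L => L v) (hd'.fderiv.symm.trans hmax.fderiv_eq_zero)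
  simp only [_root_.sub_apply, _root_.smul_apply, _root_.sum_apply, ContinuousLinearMap.comp_apply,
    ContinuousLinearMap.proj_apply, innerSL_apply_apply, smul_eq_mul, nsmul_eq_mul,
    ← Finset.mul_sum, _root_.zero_apply] at h0
  have := Real.pi_ne_zero
  have hw' : ‖w‖ ≠ 0 := norm_ne_zero_iff.2 hw
  push_cast at h0
  field_simp at h0 ⊢
  linarith

/-! ### The rotating ring as a trajectory -/

theorem rotatingRing_seven_eq (κ : ℝ) (c w : ℂ) (t : ℝ) :
    rotatingRing 7 κ c w t = fun j : Fin 7 => c +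
      Circle.exp (6 * κ / (8 * Real.pi * ‖w‖ ^ 2) * t) *
        (w * Complex.exp (2 * Real.pi * Complex.I / 7) ^ (j : ℕ)) := by
  funext j
  rw [rotatingRing, Circle.coe_exp, ← Complex.exp_nat_mul]
  congr 4
  · push_cast; norm_num
  · push_cast; ring

theorem range_rotatingRing_seven {κ : ℝ} (hκ : κ ≠ 0) (c : ℂ) {w : ℂ} (hw : w ≠ 0) :
    Set.range (rotatingRing 7 κ c w) = ringOrbit c w := by
  have hω : 6 * κ / (8 * Real.pi * ‖w‖ ^ 2) ≠ 0 := by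
    have := Real.pi_ne_zero
    have := norm_ne_zero_iff.2 hw
    positivity
  apply Set.Subset.antisymm
  · rintro _ ⟨t, rfl⟩
    exact ⟨_, (rotatingRing_seven_eq κ c w t).symm⟩
  · rintro _ ⟨u, rfl⟩
    refine ⟨(6 * κ / (8 * Real.pi * ‖w‖ ^ 2))⁻¹ * Complex.arg u, ?_⟩
    rw [rotatingRing_seven_eq, mul_inv_cancel_left₀ hω, Circle.exp_arg]

theorem hasDerivAt_rotatingRing (n : ℕ) (κ : ℝ) (c w : ℂ) (t : ℝ) :
    HasDerivAt (rotatingRing n κ c w) (fun j => Complex.I *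
      (((n - 1) * κ / (8 * Real.pi * ‖w‖ ^ 2) : ℝ) * (rotatingRing n κ c w t j - c))) t := by
  rw [hasDerivAt_pi]
  intro j
  unfold rotatingRing
  have h1 : HasDerivAt (fun t : ℝ => (((n - 1) * κ / (8 * Real.pi * ‖w‖ ^ 2) * t : ℝ) : ℂ))
      (((n - 1) * κ / (8 * Real.pi * ‖w‖ ^ 2) : ℝ) : ℂ) t := by
    simpa only [mul_one, id] using ((hasDerivAt_id t).const_mul ((n - 1) * κ / (8 * Real.pi * ‖w‖ ^ 2))).ofReal_comp
  have h2 := ((((h1.mul_const Complex.I).cexp).mul_const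
    (w * Complex.exp (2 * Real.pi * Complex.I * j / n))).const_add c)
  refine h2.congr_deriv ?_
  ring

theorem isVortexTrajectory_rotatingRing_seven {κ : ℝ} (hκ : κ ≠ 0) (c : ℂ) {w : ℂ} (hw : w ≠ 0) :
    IsVortexTrajectory κ (rotatingRing 7 κ c w) := by
  intro t
  have hO : rotatingRing 7 κ c w t ∈ ringOrbit c w :=
    range_rotatingRing_seven hκ c hw ▸ Set.mem_range_self t
  have hd := hasDerivAt_rotatingRing 7 κ c w t
  refine ⟨ringOrbit_subset_vortexPhaseSpace c hw hO, hd.differentiableAt, fun v => ?_⟩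
  rw [hd.deriv, vortexSymplecticForm_I_mul_left, fderiv_vortexHamiltonian_of_mem_ringOrbit hκ hw hO]
  simp only [← Complex.real_smul, real_inner_smul_left, ← Finset.mul_sum]
  have := Real.pi_ne_zero
  have := norm_ne_zero_iff.2 hw
  push_cast
  field_simp
  ring

/-- A motion fixing the momentum of the heptagon is a rotation about its centre. -/
theorem eq_of_affineCoadjoint_rotatingRing_seven {κ : ℝ} (hκ : κ ≠ 0) {c w : ℂ} {t : ℝ}
    {a : Circle} {b : ℂ} (h : affineCoadjoint ((7 : ℕ) * κ) a b
      (vortexMomentum κ (rotatingRing 7 κ c w t)) = vortexMomentum κ (rotatingRing 7 κ c w t)) :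
    b = c - a * c := by
  -- The centroid of the ring is `c`, so the linear momentum alone determines `b`.
  have h1 : (vortexMomentum κ (rotatingRing 7 κ c w t)).1 = 7 * κ * c := by
    have h0 : ∑ j : Fin 7, Complex.exp (2 * Real.pi * Complex.I / 7) ^ (j : ℕ) = 0 := by
      simpa using isPrimitiveRoot_exp_seven.sum_fin_pow 1
    simp only [vortexMomentum, rotatingRing_seven_eq, ← Finset.mul_sum, Finset.sum_add_distrib, h0]
    simp; ring
  have h2 := congrArg Prod.fst h
  simp only [affineCoadjoint, h1] at h2
  have hκ' : (κ : ℂ) ≠ 0 := Complex.ofReal_ne_zero.2 hκ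
  push_cast at h2
  apply mul_left_cancel₀ (mul_ne_zero (by norm_num : (7 : ℂ) ≠ 0) hκ')
  linear_combination h2

/-! ### Lyapunov stability -/

theorem exists_pos_le_norm_sub {n : ℕ} {C : Set (Fin n → ℂ)} (hC : IsCompact C)
    (hCP : C ⊆ vortexPhaseSpace n) : ∃ δ > 0, ∀ z ∈ C, ∀ i j, i ≠ j → δ ≤ ‖z i - z j‖ := by
  have h : ∀ i j : Fin n, ∀ᶠ δ in 𝓝[>] (0 : ℝ), ∀ z ∈ C, i ≠ j → δ ≤ ‖z i - z j‖ := by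
    intro i j
    by_cases hij : i = j
    · simp [hij]
    rcases C.eq_empty_or_nonempty with rfl | hne
    · simp
    obtain ⟨x, hx, hmin⟩ := hC.exists_isMinOn hne (f := fun z => ‖z i - z j‖) (by fun_prop)
    have hpos : 0 < ‖x i - x j‖ := norm_pos_iff.2 (sub_ne_zero.2 ((hCP hx).ne hij))
    filter_upwards [Ioo_mem_nhdsGT hpos] with δ hδ z hz _
    exact hδ.2.le.trans (hmin hz)
  have h' := (Filter.eventually_all.2 fun i => Filter.eventually_all.2 (h i)).and self_mem_nhdsWithin
  obtain ⟨δ, hδ, hδ0⟩ := h'.exists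
  exact ⟨δ, hδ0, fun z hz i j => hδ i j z hz⟩

theorem isVortexLyapunovStable_rotatingRing_seven {κ : ℝ} (hκ : κ ≠ 0) (c : ℂ) {w : ℂ}
    (hw : w ≠ 0) : IsVortexLyapunovStable κ (rotatingRing 7 κ c w) := by
  intro V hVP hV _
  rw [range_rotatingRing_seven hκ c hw] at hV ⊢
  have hO := isCompact_ringOrbit c w
  obtain ⟨ε₁, hε₁, hlt⟩ := exists_cthickening_ringEnergy_lt c hw
  obtain ⟨ε₂, hε₂, hsub⟩ := hO.exists_cthickening_subset_open isOpen_interior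
    (subset_interior_iff_mem_nhdsSet.2 hV)
  have hε : 0 < min ε₁ ε₂ := lt_min hε₁ hε₂
  have hC₁ := Metric.cthickening_mono (min_le_left ε₁ ε₂) (ringOrbit c w)
  have hCV : Metric.cthickening (min ε₁ ε₂) (ringOrbit c w) ⊆ V :=
    ((Metric.cthickening_mono (min_le_right ε₁ ε₂) _).trans hsub).trans interior_subset
  generalize min ε₁ ε₂ = ε at *
  have hTC := Metric.thickening_subset_cthickening ε (ringOrbit c w)
  have hcont := (continuousOn_ringEnergy c hw).mono (hCV.trans hVP)
  -- Regularising below `δ` changes nothing on the closed tube.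
  obtain ⟨δ, hδ, hsep⟩ := exists_pos_le_norm_sub hO.cthickening (hCV.trans hVP)
  obtain ⟨k, hk, hstab⟩ := exists_stable_superlevel hO hε hcont fun z hz => hlt z (hC₁ hz)
  refine ⟨{z ∈ Metric.thickening ε (ringOrbit c w) | k < ringEnergy c w z},
    fun z hz => hCV (hTC hz.1), ?_, ?_, ?_⟩
  · refine IsOpen.mem_nhdsSet ?_ |>.2 fun z hz =>
      ⟨Metric.self_subset_thickening hε _ hz, by rwa [ringEnergy_of_mem_ringOrbit hw hz]⟩
    exact (hcont.mono hTC).isOpen_inter_preimage Metric.isOpen_thickening isOpen_Ioi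
  · intro a b hab z hz
    rw [eq_of_affineCoadjoint_rotatingRing_seven hκ hab]
    refine ⟨?_, by rw [ringEnergy_planeMotion]; exact hz.2⟩
    obtain ⟨x, hx, hd⟩ := Metric.mem_thickening_iff.1 hz.1
    exact Metric.mem_thickening_iff.2
      ⟨_, planeMotion_mem_ringOrbit a hx, by rwa [dist_planeMotion]⟩
  · intro z hz
    constructor
    -- The regularised solution conserves `ringEnergy` while in the tube, hence stays there for all
    -- time and solves the original equations.
    · obtain ⟨γ, hγ0, hγ⟩ := exists_regularizedVortexField_solution κ hδ z
      have hγc : Continuous γ := continuous_iff_continuousAt.2 fun t => (hγ t).continuousAt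
      have hH : ∀ t, γ t ∈ Metric.thickening ε (ringOrbit c w) → ∀ v,
          vortexSymplecticForm κ (regularizedVortexField κ δ (γ t)) v =
            fderiv ℝ (vortexHamiltonian κ) (γ t) v := fun t ht =>
        vortexSymplecticForm_regularizedVortexField κ (hVP (hCV (hTC ht))) (hsep _ (hTC ht))
      have hU := hstab γ hγc (fun t ht => hasDerivAt_ringEnergy_comp hκ c hw (hγ t)
        (hVP (hCV (hTC ht))) (hH t ht)) (hγ0 ▸ hz.1) (hγ0 ▸ hz.2)
      refine ⟨γ, fun t => ⟨hVP (hCV (hTC (hU t).1)), (hγ t).differentiableAt, ?_⟩, hγ0⟩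
      rw [(hγ t).deriv]
      exact hH t (hU t).1
    · intro γ hγ hγ0 t
      have hγc : Continuous γ := continuous_iff_continuousAt.2 fun t => (hγ t).2.1.continuousAt
      exact hCV (hTC (hstab γ hγc (fun s _ => hasDerivAt_ringEnergy_comp hκ c hw
        (hγ s).2.1.hasDerivAt (hγ s).1 (hγ s).2.2) (hγ0 ▸ hz.1) (hγ0 ▸ hz.2) t).1)

theorem mainTheorem2 (κ : ℝ) (hκ : κ ≠ 0) (c w : ℂ) (hw : w ≠ 0) :
    IsVortexTrajectory κ (rotatingRing 7 κ c w) ∧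
      IsVortexLyapunovStable κ (rotatingRing 7 κ c w) :=
  ⟨isVortexTrajectory_rotatingRing_seven hκ c hw, isVortexLyapunovStable_rotatingRing_seven hκ c hw⟩
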